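/- Let $-\infty\le a<b\le\infty$. A real function $f$ on $(a,b)$ is called $2$-convex if $f(\lambda A+(1-\lambda)B)\le\lambda f(A)+(1-\lambda)f(B)$ for all $\lambda\in[0,1]$ and all Hermitian matrices $A,B\in M_2(\mathbb{C})$ whose eigenvalues lie in $(a,b)$. It is called $2$-monotone if $A\le B$ implies $f(A)\le f(B)$ for all such $A,B$. Let $Q_2(a,b)$ be the class of real $C^1$ functions $f$ on $(a,b)$ such that for all $\lambda_1,\lambda_2\in(a,b)$ the Loewner matrix $L=([\lambda_i,\lambda_j]_f)_{i,j=1,2}$ satisfies $\langle x, Lx\rangle\ge 0$ for every $x\in\mathbb{C}^2$ with $x_1+x_2=0$; here $[s,t]_f=\frac{f(s)-f(t)}{s-t}$ if $s\ne t$, and $[s,s]_f=f'(s)$. Then: (1) If $f$ is $2$-convex on $(a,b)$, then $f$ is differentiable on $(a,b)$ and $f'\in Q_2(a,b)$. (2) If $f$ is differentiable on $(a,b)$ and $f'$ is $2$-monotone on $(a,b)$, then $f$ is $2$-convex on $(a,b)$. (3) The function $e^t$ belongs to $Q_2(a,b)$, but it is not the derivative on $(a,b)$ of any function that is both $2$-convex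 and $2$-monotone on $(a,b)$. -/

import Mathlib

open scoped ComplexOrder

/-- The open interval `(a, b)` of the real line; the endpoints may be infinite. -/
def openInterval (a b : EReal) : Set ℝ := {t : ℝ | a < (t : EReal) ∧ (t : EReal) < b}

/-- `f` is matrix convex of order `n` on `I`. Here `cfc f A` is `f(A)`, the functional calculus of
the Hermitian matrix `A`; every `f` is continuous on the finite spectrum, so it is never a junk
value. The inequality `X ≤ Y` of Hermitian matrices is `(Y - X).PosSemidef`. -/
def MatrixConvexOn (n : ℕ) (I : Set ℝ) (f : ℝ → ℝ) : Prop :=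
  ∀ A B : Matrix (Fin n) (Fin n) ℂ, A.IsHermitian → B.IsHermitian →
    spectrum ℝ A ⊆ I → spectrum ℝ B ⊆ I →
    ∀ c : ℝ, 0 ≤ c → c ≤ 1 →
      (c • cfc f A + (1 - c) • cfc f B - cfc f (c • A + (1 - c) • B)).PosSemidef

/-- `f` is matrix monotone of order `n` on `I`. -/
def MatrixMonotoneOn (n : ℕ) (I : Set ℝ) (f : ℝ → ℝ) : Prop :=
  ∀ A B : Matrix (Fin n) (Fin n) ℂ, A.IsHermitian → B.IsHermitian →
    spectrum ℝ A ⊆ I → spectrum ℝ B ⊆ I →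
    (B - A).PosSemidef → (cfc f B - cfc f A).PosSemidef

/-- A Hermitian matrix is conditionally positive definite (almost positive) if its quadratic form is
nonnegative on the vectors whose coordinates sum to zero. -/
def CondPosDef {n : ℕ} (A : Matrix (Fin n) (Fin n) ℂ) : Prop :=
  A.IsHermitian ∧ ∀ x : Fin n → ℂ, ∑ i, x i = 0 → 0 ≤ star x ⬝ᵥ A.mulVec x

/-- The Loewner matrix of first divided differences `[l i, l j]_f`: the difference quotient of `f`
where `l i ≠ l j`, and the derivative `f' (l i)` where `l i = l j`. -/
noncomputable def loewnerMatrix {n : ℕ} (f : ℝ → ℝ) (l : Fin n → ℝ) : Matrix (Fin n) (Fin n) ℂ :=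
  Matrix.of fun i j => ((dslope f (l i) (l j) : ℝ) : ℂ)

/-- The class `Q_n(I)`, for an open interval `I`: real `C^1` functions on `I` all of whose
Loewner matrices at `n` points of `I` are conditionally positive definite. -/
def ClassQ (n : ℕ) (I : Set ℝ) : Set (ℝ → ℝ) :=
  {f | ContDiffOn ℝ 1 f I ∧
    ∀ l : Fin n → ℝ, (∀ i, l i ∈ I) → CondPosDef (loewnerMatrix f l)}

/-!
For (1), comparing the first diagonal entries of `f` at two real symmetric `2 × 2` matrices and at
their mean shows that the symmetric second difference of `f` with step `√u` is a convex function of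
`u`. Hence it behaves like `w x * u` for small `u`, and it is also convex in the base point, so the
limit `w` is convex. A continuous function whose second symmetric derivative is the continuous
function `w` is twice differentiable with second derivative `w`, and for `f'` with convex derivative
the trapezoid inequality `2 [s, t] ≤ [s, s] + [t, t]` is exactly membership in `Q_2`.

For (2), positivity of the Loewner matrices of `f'` integrates, along the segments contracting all
nodes to a point `m`, to positivity of the matrices of interpolation errors of `f`. Resolving a
Hermitian matrix `X` into eigenvectors turns this into the gradient inequality
`f(X) ≥ f(D) + Df(D)(X - D)` at every diagonal matrix `D`; taking for `D` the diagonalized convex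
combination, the linear terms cancel and convexity remains. When `f'` is not differentiable, it is
first replaced by its averages over short intervals, which are again matrix monotone.

For (3), a primitive of `exp` that is `2`-monotone would satisfy `[p, q]² ≤ exp p * exp q`, while
the logarithmic mean strictly exceeds the geometric mean.
-/

open Filter Topology Set

section PosSemidef

variable {ι : Type*}

lemma posSemidef_iff_forall_dotProduct_mulVec_nonneg [Fintype ι] {M : Matrix ι ι ℂ} :
    M.PosSemidef ↔ ∀ x : ι → ℂ, 0 ≤ star x ⬝ᵥ M.mulVec x := by
  classical
  refine ⟨fun h => h.dotProduct_mulVec_nonneg, fun h => ?_⟩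
  rw [← Matrix.isPositive_toEuclideanLin_iff, LinearMap.isPositive_iff_complex]
  intro x
  have hx : 0 ≤ inner ℂ x (M.toEuclideanLin x) := by
    rw [EuclideanSpace.inner_eq_star_dotProduct, dotProduct_comm]
    exact h x.ofLp
  rw [← inner_conj_symm, Complex.conj_eq_iff_im.mpr hx.2.symm]
  exact ⟨Complex.ext rfl hx.2, hx.1⟩

lemma posSemidef_of_tendsto [Finite ι] {α : Type*} {F : Filter α} [F.NeBot]
    {M : α → Matrix ι ι ℂ} {M₀ : Matrix ι ι ℂ} (hM : Tendsto M F (𝓝 M₀))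
    (h : ∀ᶠ t in F, (M t).PosSemidef) : M₀.PosSemidef := by
  cases nonempty_fintype ι
  rw [posSemidef_iff_forall_dotProduct_mulVec_nonneg]
  intro x
  have hform : Continuous fun N : Matrix ι ι ℂ => star x ⬝ᵥ N.mulVec x := by fun_prop
  exact ge_of_tendsto ((hform.tendsto M₀).comp hM)
    (h.mono fun t ht => ht.dotProduct_mulVec_nonneg x)

lemma le_of_hasDerivAt_nonneg {φ φ' : ℝ → ℂ} {a b : ℝ} (hab : a ≤ b)
    (hφ : ∀ t ∈ Icc a b, HasDerivAt φ (φ' t) t) (hφ' : ∀ t ∈ Icc a b, 0 ≤ φ' t) : φ a ≤ φ b := by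
  have ha := left_mem_Icc.mpr hab
  have hb := right_mem_Icc.mpr hab
  have hre : ∀ t ∈ Icc a b, HasDerivAt (fun s => (φ s).re) (φ' t).re t := fun t ht =>
    Complex.reCLM.hasFDerivAt.comp_hasDerivAt t (hφ t ht)
  have him : ∀ t ∈ Icc a b, HasDerivAt (fun s => (φ s).im) 0 t := fun t ht =>
    (Complex.imCLM.hasFDerivAt.comp_hasDerivAt t (hφ t ht)).congr_deriv (hφ' t ht).2.symm
  refine ⟨?_, ?_⟩
  · exact monotoneOn_of_hasDerivWithinAt_nonneg (convex_Icc a b)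
      (fun t ht => (hre t ht).continuousAt.continuousWithinAt)
      (fun t ht => (hre t (interior_subset ht)).hasDerivWithinAt)
      (fun t ht => (hφ' t (interior_subset ht)).1) ha hb hab
  · exact (constant_of_has_deriv_right_zero
      (fun t ht => (him t ht).continuousAt.continuousWithinAt)
      (fun t ht => (him t (Ico_subset_Icc_self ht)).hasDerivWithinAt) b hb).symm

lemma posSemidef_sub_of_hasDerivAt [Finite ι] {E E' : ℝ → Matrix ι ι ℂ} {a b : ℝ} (hab : a ≤ b)
    (hE : ∀ t ∈ Icc a b, ∀ i k, HasDerivAt (fun s => E s i k) (E' t i k) t)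
    (hE' : ∀ t ∈ Icc a b, (E' t).PosSemidef) : (E b - E a).PosSemidef := by
  cases nonempty_fintype ι
  rw [posSemidef_iff_forall_dotProduct_mulVec_nonneg]
  intro x
  have hform : ∀ t ∈ Icc a b, HasDerivAt (fun s => star x ⬝ᵥ (E s).mulVec x)
      (star x ⬝ᵥ (E' t).mulVec x) t := fun t ht =>
    HasDerivAt.fun_sum fun i _ => (HasDerivAt.fun_sum fun k _ =>
      (hE t ht i k).mul_const (x k)).const_mul (star x i)
  rw [Matrix.sub_mulVec, dotProduct_sub, sub_nonneg]
  exact le_of_hasDerivAt_nonneg hab hform fun t ht => (hE' t ht).dotProduct_mulVec_nonneg x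

end PosSemidef

section MatrixCalculus

variable {ι : Type*} [Fintype ι] [DecidableEq ι]

lemma dslope_comm {𝕜 E : Type*} [NontriviallyNormedField 𝕜] [NormedAddCommGroup E]
    [NormedSpace 𝕜 E] (g : 𝕜 → E) (s t : 𝕜) : dslope g s t = dslope g t s := by
  rcases eq_or_ne s t with rfl | h
  · rfl
  · rw [dslope_of_ne _ h, dslope_of_ne _ h.symm, slope_comm]

lemma dslope_mul_sub {𝕜 : Type*} [NontriviallyNormedField 𝕜] (g : 𝕜 → 𝕜) (s t : 𝕜) :
    dslope g s t * (t - s) = g t - g s := by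
  simpa [mul_comm] using sub_smul_dslope g s t

lemma sum_mul_star_of_mem_unitaryGroup {R : Type*} [CommRing R] [StarRing R] {U : Matrix ι ι R}
    (hU : U ∈ Matrix.unitaryGroup ι R) (i k : ι) :
    ∑ j, U i j * star (U k j) = (1 : Matrix ι ι R) i k := by
  rw [← Matrix.mem_unitaryGroup_iff.mp hU, Matrix.mul_apply]
  rfl

lemma mul_eigenvectorUnitary_apply {X : Matrix ι ι ℂ} (hX : X.IsHermitian) (i j : ι) :
    (X * hX.eigenvectorUnitary.1) i j = hX.eigenvalues j * hX.eigenvectorUnitary.1 i j :=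
  congrFun (hX.mulVec_eigenvectorBasis j) i

lemma cfc_apply_eq_sum {X : Matrix ι ι ℂ} (hX : X.IsHermitian) (f : ℝ → ℝ) (i k : ι) :
    cfc f X i k = ∑ j, (f (hX.eigenvalues j) : ℂ) *
      (hX.eigenvectorUnitary.1 i j * star (hX.eigenvectorUnitary.1 k j)) := by
  rw [hX.cfc_eq, Matrix.IsHermitian.cfc, Unitary.conjStarAlgAut_apply, Matrix.mul_apply]
  refine Finset.sum_congr rfl fun j _ => ?_
  rw [Matrix.mul_diagonal, Matrix.star_apply]
  simp only [Function.comp_apply, RCLike.ofReal_eq_complex_ofReal]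
  ring

lemma cfc_sub_diagonal_apply {X : Matrix ι ι ℂ} (hX : X.IsHermitian) (f : ℝ → ℝ) (l : ι → ℝ)
    (i k : ι) : (cfc f X - Matrix.diagonal fun i => (f (l i) : ℂ)) i k =
      ∑ j, ((f (hX.eigenvalues j) : ℂ) - f (l i)) *
        (hX.eigenvectorUnitary.1 i j * star (hX.eigenvectorUnitary.1 k j)) := by
  have hone : (Matrix.diagonal fun i => (f (l i) : ℂ)) i k =
      ∑ j, (f (l i) : ℂ) * (hX.eigenvectorUnitary.1 i j * star (hX.eigenvectorUnitary.1 k j)) := by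
    rw [← Finset.mul_sum, sum_mul_star_of_mem_unitaryGroup hX.eigenvectorUnitary.2,
      Matrix.diagonal_apply, Matrix.one_apply, mul_ite, mul_one, mul_zero]
  simp only [Matrix.sub_apply, cfc_apply_eq_sum hX, hone, ← Finset.sum_sub_distrib, ← sub_mul]

lemma cfc_sub_diagonal_apply_eq_sum_dslope {X : Matrix ι ι ℂ} (hX : X.IsHermitian) (f : ℝ → ℝ)
    (l : ι → ℝ) (i k : ι) :
    (cfc f X - Matrix.diagonal fun i => (f (l i) : ℂ)) i k =
      ∑ j, ((dslope f (l i) (hX.eigenvalues j) : ℝ) : ℂ) *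
        (((X - Matrix.diagonal fun i => (l i : ℂ)) * hX.eigenvectorUnitary.1) i j *
          star (hX.eigenvectorUnitary.1 k j)) := by
  rw [cfc_sub_diagonal_apply hX]
  refine Finset.sum_congr rfl fun j _ => ?_
  rw [Matrix.sub_mul, Matrix.sub_apply, mul_eigenvectorUnitary_apply, Matrix.diagonal_mul,
    ← Complex.ofReal_sub, ← dslope_mul_sub]
  push_cast
  ring

omit [Fintype ι] in
lemma isHermitian_diagonal_ofReal (l : ι → ℝ) :
    (Matrix.diagonal fun i => (l i : ℂ)).IsHermitian :=
  Matrix.isHermitian_diagonal_of_self_adjoint _ (funext fun i => Complex.conj_ofReal (l i))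

lemma cfc_diagonal (f : ℝ → ℝ) (l : ι → ℝ) :
    cfc f (Matrix.diagonal fun i => (l i : ℂ)) = Matrix.diagonal fun i => (f (l i) : ℂ) := by
  ext i k
  rw [← sub_eq_zero, ← Matrix.sub_apply,
    cfc_sub_diagonal_apply_eq_sum_dslope (isHermitian_diagonal_ofReal l)]
  simp only [sub_self, zero_mul, Matrix.zero_apply, mul_zero, Finset.sum_const_zero]

lemma spectrum_diagonal_subset {I : Set ℝ} {l : ι → ℝ} (hl : ∀ i, l i ∈ I) :
    spectrum ℝ (Matrix.diagonal fun i => (l i : ℂ)) ⊆ I := by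
  intro x hx
  rw [← spectrum.algebraMap_mem_iff ℂ, spectrum_diagonal] at hx
  obtain ⟨i, hi⟩ := hx
  exact (Complex.ofReal_injective hi : l i = x) ▸ hl i

open scoped Matrix.Norms.L2Operator in
lemma eventually_spectrum_subset {I : Set ℝ} (hI : IsOpen I) {X : Matrix ι ι ℂ}
    (hX : spectrum ℝ X ⊆ I) : ∀ᶠ Y in 𝓝 X, spectrum ℝ Y ⊆ I := by
  have := upperHemicontinuous_spectrum ℝ (Matrix ι ι ℂ)
  exact (this X I (hI.mem_nhdsSet.mpr hX)).mono fun Y hY => subset_of_mem_nhdsSet hY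

lemma isCompact_unitaryGroup {𝕜 : Type*} [RCLike 𝕜] :
    IsCompact (Matrix.unitaryGroup ι 𝕜 : Set (Matrix ι ι 𝕜)) := by
  have hball : IsCompact (univ.pi fun _ => univ.pi fun _ => Metric.closedBall 0 1 :
      Set (ι → ι → 𝕜)) :=
    isCompact_univ_pi fun _ => isCompact_univ_pi fun _ => isCompact_closedBall 0 1
  refine hball.of_isClosed_subset (isClosed_unitary (R := Matrix ι ι 𝕜)) fun U hU i _ k _ => ?_
  rw [mem_closedBall_zero_iff]
  exact entry_norm_bound_of_unitary hU i k

lemma eigenvalues_eq_star_mul_mul {X : Matrix ι ι ℂ} (hX : X.IsHermitian) (j : ι) :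
    (hX.eigenvalues j : ℂ) = (star hX.eigenvectorUnitary.1 * X * hX.eigenvectorUnitary.1) j j := by
  have hdiag : star hX.eigenvectorUnitary.1 * X * hX.eigenvectorUnitary.1 =
      Matrix.diagonal (RCLike.ofReal ∘ hX.eigenvalues) := by
    have h := hX.conjStarAlgAut_star_eigenvectorUnitary
    rwa [Unitary.conjStarAlgAut_star_apply] at h
  rw [hdiag, Matrix.diagonal_apply_eq]
  rfl

lemma exists_tendsto_eigenvectorUnitary {α : Type*} {𝒰 : Ultrafilter α} {X : α → Matrix ι ι ℂ}
    (hX : ∀ t, (X t).IsHermitian) {X₀ : Matrix ι ι ℂ} (h : Tendsto X 𝒰 (𝓝 X₀)) :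
    ∃ W ∈ Matrix.unitaryGroup ι ℂ, ∃ μ : ι → ℝ, (∀ i j, (X₀ * W) i j = μ j * W i j) ∧
      Tendsto (fun t => (hX t).eigenvectorUnitary.1) 𝒰 (𝓝 W) ∧
      ∀ j, Tendsto (fun t => (hX t).eigenvalues j) 𝒰 (𝓝 (μ j)) := by
  obtain ⟨W, hW, hWlim⟩ := isCompact_unitaryGroup.ultrafilter_le_nhds'
    (𝒰.map fun t : α => (hX t).eigenvectorUnitary.1)
    (Ultrafilter.mem_map.mpr (Filter.univ_mem' fun t => (hX t).eigenvectorUnitary.2))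
  replace hWlim : Tendsto (fun t => (hX t).eigenvectorUnitary.1) 𝒰 (𝓝 W) := hWlim
  have hμ (j : ι) : Tendsto (fun t => (hX t).eigenvalues j) 𝒰 (𝓝 ((star W * X₀ * W) j j).re) := by
    have hlim := (((hWlim.star.mul h).mul hWlim).apply_nhds j).apply_nhds j
    refine ((Complex.continuous_re.tendsto _).comp hlim).congr fun t => ?_
    rw [Function.comp_apply, ← eigenvalues_eq_star_mul_mul, Complex.ofReal_re]
  refine ⟨W, hW, fun j => ((star W * X₀ * W) j j).re, fun i j => ?_, hWlim, hμ⟩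
  have hleft : Tendsto (fun t => (X t * (hX t).eigenvectorUnitary.1) i j) 𝒰 (𝓝 ((X₀ * W) i j)) :=
    ((h.mul hWlim).apply_nhds i).apply_nhds j
  refine tendsto_nhds_unique hleft ?_
  simp only [mul_eigenvectorUnitary_apply]
  exact ((Complex.continuous_ofReal.tendsto _).comp (hμ j)).mul ((hWlim.apply_nhds i).apply_nhds j)

lemma exists_apply_ne_zero_of_mem_unitaryGroup {R : Type*} [CommRing R] [StarRing R] [Nontrivial R]
    {U : Matrix ι ι R} (hU : U ∈ Matrix.unitaryGroup ι R) (j : ι) : ∃ i, U i j ≠ 0 := by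
  by_contra! hzero
  have h := congrFun (congrFun (Matrix.mem_unitaryGroup_iff'.mp hU) j) j
  simp [Matrix.mul_apply, hzero] at h

lemma continuousAt_dslope {𝕜 E : Type*} [NontriviallyNormedField 𝕜] [NormedAddCommGroup E]
    [NormedSpace 𝕜 E] {g : 𝕜 → E} {s t : 𝕜} (hg : DifferentiableAt 𝕜 g t) :
    ContinuousAt (dslope g s) t := by
  rcases eq_or_ne t s with rfl | h
  · exact continuousAt_dslope_same.mpr hg
  · exact (continuousAt_dslope_of_ne h).mpr hg.continuousAt

lemma eq_of_diagonal_mul_apply {l : ι → ℝ} {W : Matrix ι ι ℂ} {μ : ℝ} {i j : ι}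
    (h : ((Matrix.diagonal fun i => (l i : ℂ)) * W) i j = μ * W i j) (hij : W i j ≠ 0) :
    μ = l i := by
  rw [Matrix.diagonal_mul] at h
  exact_mod_cast (mul_right_cancel₀ hij h).symm

lemma sum_dslope_mul_eq_of_diagonal_mul (g : ℝ → ℝ) {l μ : ι → ℝ} {W : Matrix ι ι ℂ}
    (hW : W ∈ Matrix.unitaryGroup ι ℂ)
    (hWμ : ∀ i j, ((Matrix.diagonal fun i => (l i : ℂ)) * W) i j = μ j * W i j)
    (X : Matrix ι ι ℂ) (i k : ι) :
    ∑ j, ((dslope g (l i) (μ j) : ℝ) : ℂ) * ((X * W) i j * star (W k j)) =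
      ((dslope g (l i) (l k) : ℝ) : ℂ) * X i k := by
  have hXW : X i k = ∑ j, (X * W) i j * star (W k j) := by
    conv_lhs => rw [← mul_one X, ← Matrix.mem_unitaryGroup_iff.mp hW, ← mul_assoc]
    rfl
  rw [hXW, Finset.mul_sum]
  refine Finset.sum_congr rfl fun j _ => ?_
  by_cases hkj : W k j = 0
  · simp only [hkj, star_zero, mul_zero]
  · rw [eq_of_diagonal_mul_apply (hWμ k j) hkj]

/-- The Daleckii–Krein formula. Every ultrafilter limit of the eigenvectors of
`diagonal l + ε • X` is a unitary matrix `W` with `W i j = 0` unless the `j`-th limit eigenvalue is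
`l i`, which is why the limit does not depend on the choice of eigenvectors. -/
lemma tendsto_cfc_diagonal_add_smul {g : ℝ → ℝ} {l : ι → ℝ} (hg : ∀ i, DifferentiableAt ℝ g (l i))
    {X : Matrix ι ι ℂ} (hX : X.IsHermitian) :
    Tendsto (fun ε : ℝ => ε⁻¹ • (cfc g ((Matrix.diagonal fun i => (l i : ℂ)) + ε • X) -
        Matrix.diagonal fun i => (g (l i) : ℂ))) (𝓝[≠] 0)
      (𝓝 (Matrix.of fun i k => ((dslope g (l i) (l k) : ℝ) : ℂ) * X i k)) := by
  have hH (ε : ℝ) : ((Matrix.diagonal fun i => (l i : ℂ)) + ε • X).IsHermitian :=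
    (isHermitian_diagonal_ofReal l).add ((IsSelfAdjoint.all ε).smul hX.isSelfAdjoint)
  refine (tendsto_iff_ultrafilter _ _ _).mpr fun 𝒰 h𝒰 => ?_
  have hlim : Tendsto (fun ε : ℝ => (Matrix.diagonal fun i => (l i : ℂ)) + ε • X) 𝒰
      (𝓝 (Matrix.diagonal fun i => (l i : ℂ))) := by
    have hcont : Continuous fun ε : ℝ => (Matrix.diagonal fun i => (l i : ℂ)) + ε • X := by fun_prop
    simpa using (hcont.tendsto 0).mono_left (h𝒰.trans nhdsWithin_le_nhds)
  obtain ⟨W, hW, μ, hWμ, hWlim, hμlim⟩ := exists_tendsto_eigenvectorUnitary hH hlim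
  refine tendsto_pi_nhds.mpr fun i => tendsto_pi_nhds.mpr fun k => ?_
  rw [Matrix.of_apply, ← sum_dslope_mul_eq_of_diagonal_mul g hW hWμ X i k]
  have hterm : Tendsto (fun ε : ℝ => ∑ j, ((dslope g (l i) ((hH ε).eigenvalues j) : ℝ) : ℂ) *
      ((X * (hH ε).eigenvectorUnitary.1) i j * star ((hH ε).eigenvectorUnitary.1 k j))) 𝒰
      (𝓝 (∑ j, ((dslope g (l i) (μ j) : ℝ) : ℂ) * ((X * W) i j * star (W k j)))) := by
    refine tendsto_finsetSum _ fun j _ => ?_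
    obtain ⟨m, hm⟩ := exists_apply_ne_zero_of_mem_unitaryGroup hW j
    have hds : ContinuousAt (dslope g (l i)) (μ j) := continuousAt_dslope
      (eq_of_diagonal_mul_apply (hWμ m j) hm ▸ hg m)
    exact ((Complex.continuous_ofReal.tendsto _).comp (hds.tendsto.comp (hμlim j))).mul
      ((((hWlim.const_mul X).apply_nhds i).apply_nhds j).mul
        ((hWlim.apply_nhds k).apply_nhds j).star)
  refine hterm.congr' (h𝒰 (eventually_mem_nhdsWithin.mono fun ε hε => ?_))
  refine Eq.trans ?_ (congrArg (ε⁻¹ • ·)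
    (cfc_sub_diagonal_apply_eq_sum_dslope (hH ε) g l i k)).symm
  rw [Finset.smul_sum]
  refine Finset.sum_congr rfl fun j _ => ?_
  rw [add_sub_cancel_left, Matrix.smul_mul, Matrix.smul_apply, smul_mul_assoc, mul_smul_comm,
    inv_smul_smul₀ hε]

lemma MatrixMonotoneOn.posSemidef_loewnerMatrix {n : ℕ} {I : Set ℝ} {g : ℝ → ℝ}
    (hg : MatrixMonotoneOn n I g) (hI : IsOpen I) {l : Fin n → ℝ} (hl : ∀ i, l i ∈ I)
    (hd : ∀ i, DifferentiableAt ℝ g (l i)) : (loewnerMatrix g l).PosSemidef := by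
  have hones : (Matrix.vecMulVec 1 (star 1) : Matrix (Fin n) (Fin n) ℂ).PosSemidef :=
    Matrix.posSemidef_vecMulVec_self_star 1
  have hspec := spectrum_diagonal_subset hl
  have hlim := tendsto_cfc_diagonal_add_smul hd hones.isHermitian
  have hL : (Matrix.of fun i k => ((dslope g (l i) (l k) : ℝ) : ℂ) *
      (Matrix.vecMulVec 1 (star 1) : Matrix (Fin n) (Fin n) ℂ) i k) = loewnerMatrix g l := by
    ext i k
    simp [Matrix.vecMulVec_apply, loewnerMatrix]
  rw [hL] at hlim
  have hcont : Tendsto (fun ε : ℝ => (Matrix.diagonal fun i => (l i : ℂ)) +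
      ε • (Matrix.vecMulVec 1 (star 1) : Matrix (Fin n) (Fin n) ℂ)) (𝓝[>] 0)
      (𝓝 (Matrix.diagonal fun i => (l i : ℂ))) :=
    Continuous.tendsto' (by fun_prop) _ _ (by simp) |>.mono_left nhdsWithin_le_nhds
  refine posSemidef_of_tendsto (hlim.mono_left (nhdsGT_le_nhdsNE 0)) ?_
  filter_upwards [hcont.eventually (eventually_spectrum_subset hI hspec), self_mem_nhdsWithin]
    with ε hε hpos
  have hsmul := hones.smul (mem_Ioi.mp hpos).le
  refine Matrix.PosSemidef.smul ?_ (inv_nonneg.mpr (mem_Ioi.mp hpos).le)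
  rw [← cfc_diagonal]
  have hdiag := isHermitian_diagonal_ofReal l
  exact hg _ _ hdiag (hdiag.add hsmul.isHermitian) hspec hε (by rwa [add_sub_cancel_left])

end MatrixCalculus

/-- The matrix whose `(i, k)` entry is the error at `m` of the affine interpolation of `f` at the
nodes `l i` and `l k`, the tangent line being used where the nodes coincide. Its positivity for all
nodes and all `m` is a gradient inequality for the functional calculus of `f`. -/
noncomputable def interpolationError {ι : Type*} (f : ℝ → ℝ) (l : ι → ℝ) (m : ℝ) :
    Matrix ι ι ℂ :=
  Matrix.of fun i k => ((f m - f (l i) - dslope f (l i) (l k) * (m - l i) : ℝ) : ℂ)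

section InterpolationError

variable {I : Set ℝ} {f g : ℝ → ℝ} {n : ℕ}

lemma hasDerivAt_tangent_error_segment (hI : IsOpen I) (hf : ∀ x ∈ I, HasDerivAt f (g x) x)
    {p m t : ℝ} (hp : m + t * (p - m) ∈ I) (hg : DifferentiableAt ℝ g (m + t * (p - m))) :
    HasDerivAt (fun s => f m - f (m + s * (p - m)) - deriv f (m + s * (p - m)) *
        (m - (m + s * (p - m))))
      ((p - m) * (t * deriv g (m + t * (p - m))) * (p - m)) t := by
  have hy : HasDerivAt (fun s => m + s * (p - m)) (p - m) t := by
    simpa using ((hasDerivAt_id t).mul_const (p - m)).const_add m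
  have hev : (fun s => g (m + s * (p - m))) =ᶠ[𝓝 t] fun s => deriv f (m + s * (p - m)) :=
    (hy.continuousAt.eventually (hI.mem_nhds hp)).mono fun s hs => (hf _ hs).deriv.symm
  have hf' := ((hg.hasDerivAt.comp t hy).congr_of_eventuallyEq hev.symm)
  refine ((((hf _ hp).comp t hy).const_sub (f m)).sub (hf'.mul (hy.const_sub m))).congr_deriv ?_
  rw [(hf _ hp).deriv]
  ring

lemma hasDerivAt_secant_error_segment (hf : ∀ x ∈ I, HasDerivAt f (g x) x) {p q m t : ℝ}
    (hpq : p ≠ q) (hp : m + t * (p - m) ∈ I) (hq : m + t * (q - m) ∈ I) :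
    HasDerivAt (fun s => f m - f (m + s * (p - m)) -
        dslope f (m + s * (p - m)) (m + s * (q - m)) * (m - (m + s * (p - m))))
      ((p - m) * (t * dslope g (m + t * (p - m)) (m + t * (q - m))) * (q - m)) t := by
  have hqp : q - p ≠ 0 := sub_ne_zero.mpr hpq.symm
  have hy (r : ℝ) : HasDerivAt (fun s => m + s * (r - m)) (r - m) t := by
    simpa using ((hasDerivAt_id t).mul_const (r - m)).const_add m
  have hscale (φ : ℝ → ℝ) (s : ℝ) : s * dslope φ (m + s * (p - m)) (m + s * (q - m)) =
      (φ (m + s * (q - m)) - φ (m + s * (p - m))) / (q - p) := by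
    rw [eq_div_iff hqp, ← dslope_mul_sub]
    ring
  have hP := (hf _ hp).comp t (hy p)
  have hQ := (hf _ hq).comp t (hy q)
  have hsec := (hP.const_sub (f m)).add (((hQ.sub hP).div_const (q - p)).mul_const (p - m))
  refine (hsec.congr_deriv ?_).congr_of_eventuallyEq (Eventually.of_forall fun s => ?_)
  · rw [hscale g]
    field_simp
    ring
  · simp only [Pi.add_apply, Pi.sub_apply, Function.comp_apply]
    linear_combination (p - m) * hscale f s

lemma hasDerivAt_interpolationError_segment (hI : IsOpen I) (hf : ∀ x ∈ I, HasDerivAt f (g x) x)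
    (hg : DifferentiableOn ℝ g I) {l : Fin n → ℝ} {m t : ℝ} (hl : ∀ i, m + t * (l i - m) ∈ I)
    (i k : Fin n) :
    HasDerivAt (fun s => interpolationError f (fun j => m + s * (l j - m)) m i k)
      (((l i - m) * (t * dslope g (m + t * (l i - m)) (m + t * (l k - m))) * (l k - m) : ℝ) : ℂ)
      t := by
  refine HasDerivAt.ofReal_comp ?_
  rcases eq_or_ne (l i) (l k) with hik | hik
  · simp only [← hik, dslope_same]
    exact hasDerivAt_tangent_error_segment hI hf (hl i) (hg.differentiableAt (hI.mem_nhds (hl i)))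
  · exact hasDerivAt_secant_error_segment hf hik (hl i) (hl k)

lemma posSemidef_interpolationError_of_loewnerMatrix (hI : IsOpen I) (hc : Convex ℝ I)
    (hf : ∀ x ∈ I, HasDerivAt f (g x) x) (hg : DifferentiableOn ℝ g I)
    (hL : ∀ l : Fin n → ℝ, (∀ i, l i ∈ I) → (loewnerMatrix g l).PosSemidef)
    {l : Fin n → ℝ} (hl : ∀ i, l i ∈ I) {m : ℝ} (hm : m ∈ I) :
    (interpolationError f l m).PosSemidef := by
  have hmem : ∀ t ∈ Icc (0 : ℝ) 1, ∀ i, m + t * (l i - m) ∈ I := fun t ht i =>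
    hc.add_smul_sub_mem hm (hl i) ht
  have h := posSemidef_sub_of_hasDerivAt zero_le_one
    (fun t ht => hasDerivAt_interpolationError_segment hI hf hg (hmem t ht))
    (E' := fun t => Matrix.of fun i k => (((l i - m) *
      (t * dslope g (m + t * (l i - m)) (m + t * (l k - m))) * (l k - m) : ℝ) : ℂ)) ?_
  · convert h using 1
    ext i k
    simp [interpolationError]
  · intro t ht
    convert ((hL _ (hmem t ht)).smul ht.1).mul_mul_conjTranspose_same
      (Matrix.diagonal fun i => ((l i - m : ℝ) : ℂ)) using 1
    ext i k
    simp [loewnerMatrix, Matrix.diagonal_conjTranspose, Matrix.mul_diagonal, Matrix.diagonal_mul]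

end InterpolationError

section MonotoneDerivative

variable {n : ℕ} {I : Set ℝ} {f g : ℝ → ℝ}

lemma MatrixMonotoneOn.comp_add_const (hg : MatrixMonotoneOn n I g) (y : ℝ) :
    MatrixMonotoneOn n {x | x + y ∈ I} fun x => g (x + y) := by
  have hcont (φ : ℝ → ℝ) (S : Set ℝ) (hS : S.Finite) : ContinuousOn φ S := hS.continuousOn φ
  have hadd {X : Matrix (Fin n) (Fin n) ℂ} (hX : X.IsHermitian) :
      cfc (· + y) X = X + algebraMap ℝ _ y := by
    rw [cfc_add_const y (fun x => x) X (hcont _ _ X.finite_real_spectrum) hX.isSelfAdjoint,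
      cfc_id' ℝ X]
  have hcomp {X : Matrix (Fin n) (Fin n) ℂ} (hX : X.IsHermitian) :
      cfc (fun x => g (x + y)) X = cfc g (X + algebraMap ℝ _ y) := by
    rw [cfc_comp' g (· + y) X (hcont _ _ (X.finite_real_spectrum.image _))
      (hcont _ _ X.finite_real_spectrum) hX.isSelfAdjoint, hadd hX]
  have hspec {X : Matrix (Fin n) (Fin n) ℂ} (hX : X.IsHermitian)
      (hXI : spectrum ℝ X ⊆ {x | x + y ∈ I}) : spectrum ℝ (X + algebraMap ℝ _ y) ⊆ I := by
    rw [← hadd hX, cfc_map_spectrum (· + y) X hX.isSelfAdjoint (hcont _ _ X.finite_real_spectrum)]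
    exact image_subset_iff.mpr hXI
  have hherm {X : Matrix (Fin n) (Fin n) ℂ} (hX : X.IsHermitian) :
      (X + algebraMap ℝ (Matrix (Fin n) (Fin n) ℂ) y).IsHermitian :=
    hX.isSelfAdjoint.add (.algebraMap _ (.all y))
  intro A B hA hB hAI hBI hAB
  rw [hcomp hA, hcomp hB]
  exact hg _ _ (hherm hA) (hherm hB) (hspec hA hAI) (hspec hB hBI)
    (by rwa [add_sub_add_right_eq_sub])

/-- The forward difference quotient of `f` with step `h`, as a function of the base point. It
approximates the derivative by a function that inherits the regularity of `f`. -/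
noncomputable def diffQuot (h : ℝ) (f : ℝ → ℝ) (x : ℝ) : ℝ := (f (x + h) - f x) / h

lemma hasDerivAt_diffQuot {h x f₀ f₁ : ℝ} (hx : HasDerivAt f f₀ x)
    (hxh : HasDerivAt f f₁ (x + h)) : HasDerivAt (diffQuot h f) ((f₁ - f₀) / h) x :=
  ((hxh.comp_add_const x h).sub hx).div_const h

lemma tendsto_diffQuot {f' x : ℝ} (hf : HasDerivAt f f' x) :
    Tendsto (fun h => diffQuot h f x) (𝓝[>] 0) (𝓝 f') := by
  have hslope := (hasDerivAt_iff_tendsto_slope_zero.mp hf).mono_left (nhdsGT_le_nhdsNE 0)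
  refine hslope.congr fun h => ?_
  rw [smul_eq_mul, inv_mul_eq_div, diffQuot]

/-- The difference quotient is an average of translates of `g`. -/
lemma MatrixMonotoneOn.diffQuot_of_hasDerivAt (hg : MatrixMonotoneOn n I g) (hc : Convex ℝ I)
    (hf : ∀ x ∈ I, HasDerivAt f (g x) x) {h : ℝ} (hh : 0 ≤ h) :
    MatrixMonotoneOn n {x | x ∈ I ∧ x + h ∈ I} (diffQuot h f) := by
  intro A B hA hB hAI hBI hAB
  have hmem {x y : ℝ} (hx : x ∈ I ∧ x + h ∈ I) (hy : y ∈ Icc 0 h) : x + y ∈ I :=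
    hc.ordConnected.out hx.1 hx.2 ⟨le_add_of_nonneg_right hy.1, add_le_add_right hy.2 x⟩
  have hcfc {X : Matrix (Fin n) (Fin n) ℂ} (hX : X.IsHermitian)
      (hXI : spectrum ℝ X ⊆ {x | x ∈ I ∧ x + h ∈ I}) {y : ℝ} (hy : y ∈ Icc 0 h) (i k : Fin n) :
      HasDerivAt (fun y => cfc (fun x => f (x + y)) X i k) (cfc (fun x => g (x + y)) X i k) y := by
    simp only [cfc_apply_eq_sum hX]
    exact HasDerivAt.fun_sum fun j _ => ((hf _ (hmem (hXI (hX.eigenvalues_mem_spectrum_real j)) hy)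
      |>.comp_const_add _ y).ofReal_comp).mul_const _
  have hE := posSemidef_sub_of_hasDerivAt hh
    (E := fun y => cfc (fun x => f (x + y)) B - cfc (fun x => f (x + y)) A)
    (fun y hy i k => (hcfc hB hBI hy i k).sub (hcfc hA hAI hy i k))
    (fun y hy => hg.comp_add_const y A B hA hB (fun x hx => hmem (hAI hx) hy)
      (fun x hx => hmem (hBI hx) hy) hAB)
  convert hE.smul (inv_nonneg.mpr hh) using 1
  ext i k
  simp only [Matrix.sub_apply, Matrix.smul_apply, cfc_apply_eq_sum hA, cfc_apply_eq_sum hB,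
    ← Finset.sum_sub_distrib, Finset.smul_sum, add_zero, diffQuot, Complex.real_smul]
  refine Finset.sum_congr rfl fun j _ => ?_
  push_cast
  ring

lemma exists_antideriv (hI : IsOpen I) (hc : Convex ℝ I) (hf : ContinuousOn f I) :
    ∃ F : ℝ → ℝ, ∀ x ∈ I, HasDerivAt F (f x) x := by
  rcases I.eq_empty_or_nonempty with rfl | ⟨x₀, hx₀⟩
  · exact ⟨0, by simp⟩
  refine ⟨fun x => ∫ t in x₀..x, f t, fun x hx => ?_⟩
  have hsub : uIcc x₀ x ⊆ I := hc.ordConnected.uIcc_subset hx₀ hx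
  exact intervalIntegral.integral_hasDerivAt_right (hf.mono hsub).intervalIntegrable
    (hf.stronglyMeasurableAtFilter hI x hx) (hf.continuousAt (hI.mem_nhds hx))

lemma eventually_add_mem (hI : IsOpen I) {x : ℝ} (hx : x ∈ I) : ∀ᶠ h in 𝓝 (0 : ℝ), x + h ∈ I :=
  (continuous_const_add x).continuousAt.eventually_mem (hI.mem_nhds (by rwa [add_zero]))

lemma tendsto_interpolationError_diffQuot {F : ℝ → ℝ} (hI : IsOpen I)
    (hF : ∀ x ∈ I, HasDerivAt F (f x) x) (hf : DifferentiableOn ℝ f I) {l : Fin n → ℝ}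
    (hl : ∀ i, l i ∈ I) {m : ℝ} (hm : m ∈ I) :
    Tendsto (fun h => interpolationError (diffQuot h F) l m) (𝓝[>] 0)
      (𝓝 (interpolationError f l m)) := by
  have hlim {x : ℝ} (hx : x ∈ I) := tendsto_diffQuot (hF x hx)
  refine tendsto_pi_nhds.mpr fun i => tendsto_pi_nhds.mpr fun k =>
    (Complex.continuous_ofReal.tendsto _).comp (((hlim hm).sub (hlim (hl i))).sub
      (Tendsto.mul_const (m - l i) ?_))
  rcases eq_or_ne (l k) (l i) with hik | hik
  · simp only [hik, dslope_same]
    have hfi := hf.differentiableAt (hI.mem_nhds (hl i))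
    refine (tendsto_diffQuot hfi.hasDerivAt).congr' ?_
    filter_upwards [nhdsWithin_le_nhds (eventually_add_mem hI (hl i))] with h hh
    exact (hasDerivAt_diffQuot (hF _ (hl i)) (hF _ hh)).deriv.symm
  · simp only [dslope_of_ne _ hik, slope_def_field]
    exact ((hlim (hl k)).sub (hlim (hl i))).div_const _

lemma MatrixMonotoneOn.posSemidef_interpolationError (hg : MatrixMonotoneOn n I g) (hI : IsOpen I)
    (hc : Convex ℝ I) (hf : ∀ x ∈ I, HasDerivAt f (g x) x) {l : Fin n → ℝ} (hl : ∀ i, l i ∈ I)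
    {m : ℝ} (hm : m ∈ I) : (interpolationError f l m).PosSemidef := by
  obtain ⟨F, hF⟩ := exists_antideriv hI hc fun x hx => (hf x hx).continuousAt.continuousWithinAt
  have hfd : DifferentiableOn ℝ f I := fun x hx => (hf x hx).differentiableAt.differentiableWithinAt
  refine posSemidef_of_tendsto (tendsto_interpolationError_diffQuot hI hF hfd hl hm) ?_
  filter_upwards [nhdsWithin_le_nhds (eventually_all.mpr fun i => eventually_add_mem hI (hl i)),
    nhdsWithin_le_nhds (eventually_add_mem hI hm), self_mem_nhdsWithin] with h hlh hmh hpos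
  have hopen : IsOpen {x | x ∈ I ∧ x + h ∈ I} := hI.inter (hI.preimage (continuous_add_const h))
  have hconv : Convex ℝ {x | x ∈ I ∧ x + h ∈ I} := hc.inter (hc.translate_preimage_left h)
  have hdiff : ∀ x ∈ {x | x ∈ I ∧ x + h ∈ I},
      HasDerivAt (diffQuot h f) ((g (x + h) - g x) / h) x :=
    fun x hx => hasDerivAt_diffQuot (hf x hx.1) (hf _ hx.2)
  refine posSemidef_interpolationError_of_loewnerMatrix hopen hconv
    (fun x hx => hasDerivAt_diffQuot (hF x hx.1) (hF _ hx.2))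
    (fun x hx => (hdiff x hx).differentiableAt.differentiableWithinAt) (fun p hp => ?_)
    (fun i => ⟨hl i, hlh i⟩) ⟨hm, hmh⟩
  exact (hg.diffQuot_of_hasDerivAt hc hf (mem_Ioi.mp hpos).le).posSemidef_loewnerMatrix hopen hp
    fun i => (hdiff _ (hp i)).differentiableAt

end MonotoneDerivative

section GradientInequality

variable {ι : Type*} [Fintype ι] [DecidableEq ι] {I : Set ℝ} {f : ℝ → ℝ}

/-- With `W` the matrix of eigenvectors and `μ` the eigenvalues of `X`, the matrix in the statement
is the sum over `j` of the matrices of interpolation errors at `μ j`, each conjugated by the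
diagonal matrix of the `j`-th eigenvector. -/
lemma posSemidef_cfc_sub_linearization {l : ι → ℝ} {X : Matrix ι ι ℂ} (hX : X.IsHermitian)
    (hf : ∀ m ∈ spectrum ℝ X, (interpolationError f l m).PosSemidef) :
    ((cfc f X - Matrix.diagonal fun i => (f (l i) : ℂ)) -
      Matrix.of fun i k => ((dslope f (l i) (l k) : ℝ) : ℂ) *
        (X - Matrix.diagonal fun i => (l i : ℂ)) i k).PosSemidef := by
  have hsum : (∑ j, Matrix.diagonal (fun i => hX.eigenvectorUnitary.1 i j) *
      interpolationError f l (hX.eigenvalues j) *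
      (Matrix.diagonal (fun i => hX.eigenvectorUnitary.1 i j)).conjTranspose).PosSemidef :=
    Matrix.posSemidef_sum _ fun j _ =>
      (hf _ (hX.eigenvalues_mem_spectrum_real j)).mul_mul_conjTranspose_same _
  convert hsum using 1
  ext i k
  have hid := cfc_sub_diagonal_apply hX id l i k
  rw [cfc_id ℝ X hX.isSelfAdjoint] at hid
  simp only [id_eq] at hid
  rw [Matrix.sub_apply, cfc_sub_diagonal_apply hX, Matrix.of_apply, hid, Matrix.sum_apply,
    Finset.mul_sum, ← Finset.sum_sub_distrib]
  refine Finset.sum_congr rfl fun j _ => ?_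
  rw [Matrix.diagonal_conjTranspose, Matrix.mul_diagonal, Matrix.diagonal_mul,
    interpolationError, Matrix.of_apply, Pi.star_apply]
  push_cast
  ring

lemma re_apply_self_mem_of_spectrum_subset (hI : Convex ℝ I) {X : Matrix ι ι ℂ}
    (hX : X.IsHermitian) (hXI : spectrum ℝ X ⊆ I) (i : ι) : (X i i).re ∈ I := by
  have hweight : ∑ j, ‖hX.eigenvectorUnitary.1 i j‖ ^ 2 = 1 := by
    have h := sum_mul_star_of_mem_unitaryGroup hX.eigenvectorUnitary.2 i i
    simp only [RCLike.star_def, Complex.mul_conj', Matrix.one_apply_eq] at h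
    exact_mod_cast h
  have hmean : (X i i).re = ∑ j, ‖hX.eigenvectorUnitary.1 i j‖ ^ 2 • hX.eigenvalues j := by
    have h := cfc_apply_eq_sum hX id i i
    rw [cfc_id ℝ X hX.isSelfAdjoint] at h
    simp only [id_eq, RCLike.star_def, Complex.mul_conj'] at h
    rw [h]
    norm_cast
    exact Finset.sum_congr rfl fun j _ => mul_comm _ _
  rw [hmean]
  exact hI.sum_mem (fun j _ => sq_nonneg _) hweight
    fun j _ => hXI (hX.eigenvalues_mem_spectrum_real j)

lemma cfc_conjStarAlgAut (f : ℝ → ℝ) (U : Matrix.unitaryGroup ι ℂ) {X : Matrix ι ι ℂ}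
    (hX : X.IsHermitian) : cfc f (Unitary.conjStarAlgAut ℝ _ U X) =
      Unitary.conjStarAlgAut ℝ _ U (cfc f X) := by
  have hcont : Continuous (Unitary.conjStarAlgAut ℝ (Matrix ι ι ℂ) U) := by
    have h : Continuous fun Y : Matrix ι ι ℂ =>
        (U : Matrix ι ι ℂ) * Y * star (U : Matrix ι ι ℂ) := by
      fun_prop
    exact h
  exact (StarAlgHomClass.map_cfc (S := ℝ) (Unitary.conjStarAlgAut ℝ (Matrix ι ι ℂ) U) f X
    (X.finite_real_spectrum.continuousOn f) hcont hX.isSelfAdjoint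
    (hX.isSelfAdjoint.map _)).symm

lemma posSemidef_jensen_of_diagonal (hI : Convex ℝ I)
    (h : ∀ l : ι → ℝ, (∀ i, l i ∈ I) → ∀ m ∈ I, (interpolationError f l m).PosSemidef)
    {A B : Matrix ι ι ℂ} (hA : A.IsHermitian) (hB : B.IsHermitian) (hAI : spectrum ℝ A ⊆ I)
    (hBI : spectrum ℝ B ⊆ I) {c : ℝ} (hc₀ : 0 ≤ c) (hc₁ : c ≤ 1) {l : ι → ℝ}
    (hl : c • A + (1 - c) • B = Matrix.diagonal fun i => (l i : ℂ)) :
    (c • cfc f A + (1 - c) • cfc f B - Matrix.diagonal fun i => (f (l i) : ℂ)).PosSemidef := by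
  have hlI (i : ι) : l i ∈ I := by
    have hre : l i = c • (A i i).re + (1 - c) • (B i i).re := by
      simpa using (congrArg (fun M : Matrix ι ι ℂ => (M i i).re) hl).symm
    rw [hre]
    exact hI (re_apply_self_mem_of_spectrum_subset hI hA hAI i)
      (re_apply_self_mem_of_spectrum_subset hI hB hBI i) hc₀ (sub_nonneg.mpr hc₁)
      (add_sub_cancel c 1)
  have hgradA := posSemidef_cfc_sub_linearization hA fun m hm => h l hlI m (hAI hm)
  have hgradB := posSemidef_cfc_sub_linearization hB fun m hm => h l hlI m (hBI hm)
  convert (hgradA.smul hc₀).add (hgradB.smul (sub_nonneg.mpr hc₁)) using 1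
  ext i k
  have hlik := congrFun (congrFun hl i) k
  simp only [Matrix.add_apply, Matrix.sub_apply, Matrix.smul_apply, Matrix.of_apply,
    Complex.real_smul] at hlik ⊢
  push_cast at hlik ⊢
  linear_combination ((dslope f (l i) (l k) : ℝ) : ℂ) * hlik

lemma matrixConvexOn_of_posSemidef_interpolationError {n : ℕ} (hI : Convex ℝ I)
    (h : ∀ l : Fin n → ℝ, (∀ i, l i ∈ I) → ∀ m ∈ I, (interpolationError f l m).PosSemidef) :
    MatrixConvexOn n I f := by
  intro A B hA hB hAI hBI c hc₀ hc₁
  have hC : (c • A + (1 - c) • B).IsHermitian :=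
    ((IsSelfAdjoint.all c).smul hA.isSelfAdjoint).add
      ((IsSelfAdjoint.all (1 - c)).smul hB.isSelfAdjoint)
  let φ := Unitary.conjStarAlgAut ℝ (Matrix (Fin n) (Fin n) ℂ) (star hC.eigenvectorUnitary)
  have hφC : φ (c • A + (1 - c) • B) = Matrix.diagonal fun i => (hC.eigenvalues i : ℂ) :=
    hC.conjStarAlgAut_star_eigenvectorUnitary
  have hmean : c • φ A + (1 - c) • φ B = Matrix.diagonal fun i => (hC.eigenvalues i : ℂ) := by
    rw [← hφC, map_add, map_smul, map_smul]
  have hspec (X : Matrix (Fin n) (Fin n) ℂ) : spectrum ℝ (φ X) = spectrum ℝ X :=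
    AlgEquiv.spectrum_eq φ X
  have hjensen := posSemidef_jensen_of_diagonal hI h (hA.isSelfAdjoint.map φ)
    (hB.isSelfAdjoint.map φ) ((hspec A).trans_subset hAI) ((hspec B).trans_subset hBI) hc₀ hc₁ hmean
  rw [← cfc_diagonal, ← hφC, cfc_conjStarAlgAut f _ hA, cfc_conjStarAlgAut f _ hB,
    cfc_conjStarAlgAut f _ hC, ← map_smul, ← map_smul, ← map_add, ← map_sub,
    Unitary.conjStarAlgAut_star_apply] at hjensen
  exact (Matrix.IsUnit.posSemidef_star_left_conjugate_iff
    (Unitary.isUnit_coe (U := hC.eigenvectorUnitary))).mp hjensen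

lemma MatrixMonotoneOn.matrixConvexOn {n : ℕ} {g : ℝ → ℝ} (hg : MatrixMonotoneOn n I g)
    (hI : IsOpen I) (hc : Convex ℝ I) (hf : ∀ x ∈ I, HasDerivAt f (g x) x) :
    MatrixConvexOn n I f :=
  matrixConvexOn_of_posSemidef_interpolationError hc fun _ hl _ hm =>
    hg.posSemidef_interpolationError hI hc hf hl hm

end GradientInequality

section TwoPointMatrix

lemma cfc_re_apply_diagonal {n : ℕ} (f : ℝ → ℝ) (l : Fin n → ℝ) (i : Fin n) :
    (cfc f (Matrix.diagonal fun i => (l i : ℂ)) i i).re = f (l i) := by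
  rw [cfc_diagonal, Matrix.diagonal_apply_eq, Complex.ofReal_re]

lemma smul_diagonal_add_smul_diagonal {ι : Type*} [DecidableEq ι] (s t : ℝ) (k l : ι → ℝ) :
    s • (Matrix.diagonal fun i => (k i : ℂ)) + t • (Matrix.diagonal fun i => (l i : ℂ)) =
      Matrix.diagonal fun i => ((s * k i + t * l i : ℝ) : ℂ) := by
  rw [← Matrix.diagonal_smul, ← Matrix.diagonal_smul, Matrix.diagonal_add]
  congr 1
  ext i
  simp

lemma MatrixConvexOn.re_cfc_apply_self_le {n : ℕ} {I : Set ℝ} {f : ℝ → ℝ}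
    (h : MatrixConvexOn n I f) {A B : Matrix (Fin n) (Fin n) ℂ} (hA : A.IsHermitian)
    (hB : B.IsHermitian) (hAI : spectrum ℝ A ⊆ I) (hBI : spectrum ℝ B ⊆ I) {c : ℝ} (hc₀ : 0 ≤ c)
    (hc₁ : c ≤ 1) (i : Fin n) :
    (cfc f (c • A + (1 - c) • B) i i).re ≤ c * (cfc f A i i).re + (1 - c) * (cfc f B i i).re := by
  have := (h A B hA hB hAI hBI c hc₀ hc₁).diag_nonneg (i := i)
  have hre := (Complex.le_def.mp this).1
  simpa using hre

lemma MatrixConvexOn.convexOn {n : ℕ} [NeZero n] {I : Set ℝ} {f : ℝ → ℝ} (hI : Convex ℝ I)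
    (h : MatrixConvexOn n I f) : ConvexOn ℝ I f := by
  refine ⟨hI, fun x hx y hy s t hs ht hst => ?_⟩
  obtain rfl : t = 1 - s := by linarith
  have := h.re_cfc_apply_self_le (isHermitian_diagonal_ofReal fun _ => x)
    (isHermitian_diagonal_ofReal fun _ => y) (spectrum_diagonal_subset fun _ => hx)
    (spectrum_diagonal_subset fun _ => hy) hs (by linarith) 0
  rwa [smul_diagonal_add_smul_diagonal, cfc_re_apply_diagonal, cfc_re_apply_diagonal,
    cfc_re_apply_diagonal] at this

lemma spectrum_subset_pair_of_mul_eq_zero {A : Type*} [Ring A] [Algebra ℝ A] {a : A} {μ ν : ℝ}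
    (h : (a - algebraMap ℝ A μ) * (a - algebraMap ℝ A ν) = 0) : spectrum ℝ a ⊆ {μ, ν} := by
  cases subsingleton_or_nontrivial A
  · simp only [spectrum.of_subsingleton, empty_subset]
  intro x hx
  have hroot := spectrum.subset_polynomial_aeval a
    ((Polynomial.X - Polynomial.C μ) * (Polynomial.X - Polynomial.C ν)) ⟨x, hx, rfl⟩
  simp only [map_mul, map_sub, Polynomial.aeval_X, Polynomial.aeval_C, h, spectrum.zero_eq,
    Polynomial.eval_mul, Polynomial.eval_sub, Polynomial.eval_X, Polynomial.eval_C,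
    mem_singleton_iff, mul_eq_zero, sub_eq_zero] at hroot
  exact hroot

lemma smul_cfc_of_spectrum_subset_pair {ι : Type*} [Fintype ι] [DecidableEq ι]
    {X : Matrix ι ι ℂ} (hX : X.IsHermitian) {μ ν : ℝ} (h : spectrum ℝ X ⊆ {μ, ν}) (f : ℝ → ℝ) :
    (ν - μ) • cfc f X = (f μ * ν - f ν * μ) • (1 : Matrix ι ι ℂ) + (f ν - f μ) • X := by
  have hsa : IsSelfAdjoint X := hX
  have hf : ContinuousOn f (spectrum ℝ X) := X.finite_real_spectrum.continuousOn f
  have hchord : (spectrum ℝ X).EqOn (fun x => (ν - μ) * f x)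
      fun x => (f μ * ν - f ν * μ) + (f ν - f μ) * x := by
    intro x hx
    rcases h hx with rfl | rfl <;> ring
  rw [← cfc_const_mul (ν - μ) f X, cfc_congr hchord, cfc_const_add _ _ X, cfc_const_mul_id _ X,
    Algebra.algebraMap_eq_smul_one]

/-- The real symmetric `2 × 2` matrix with eigenvalues `x + s` and `x - t` and first diagonal
entry `x`, for `0 ≤ s * t`. Averaging it with the matrix in which `s` and `t` are exchanged gives
the one with both parameters equal to `√(s * t)`. -/
noncomputable def twoPointMatrix (x s t : ℝ) : Matrix (Fin 2) (Fin 2) ℂ :=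
  !![(x : ℂ), (√(s * t) : ℂ); (√(s * t) : ℂ), ((x + s - t : ℝ) : ℂ)]

lemma isHermitian_twoPointMatrix (x s t : ℝ) : (twoPointMatrix x s t).IsHermitian := by
  ext i j
  fin_cases i <;> fin_cases j <;> simp [twoPointMatrix]

lemma spectrum_twoPointMatrix_subset (x : ℝ) {s t : ℝ} (hst : 0 ≤ s * t) :
    spectrum ℝ (twoPointMatrix x s t) ⊆ {x - t, x + s} := by
  have hsq : (√(s * t) : ℂ) * √(s * t) = s * t := by
    exact_mod_cast Real.mul_self_sqrt hst
  refine spectrum_subset_pair_of_mul_eq_zero ?_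
  ext i j
  fin_cases i <;> fin_cases j <;>
    simp [twoPointMatrix, Matrix.mul_apply, Fin.sum_univ_two, Matrix.algebraMap_matrix_apply, hsq]
    <;> ring

lemma re_cfc_twoPointMatrix (f : ℝ → ℝ) (x : ℝ) {s t : ℝ} (hst : 0 ≤ s * t) :
    (s + t) * (cfc f (twoPointMatrix x s t) 0 0).re = t * f (x + s) + s * f (x - t) := by
  have h := congrArg (fun M : Matrix (Fin 2) (Fin 2) ℂ => (M 0 0).re)
    (smul_cfc_of_spectrum_subset_pair (isHermitian_twoPointMatrix x s t)
      (spectrum_twoPointMatrix_subset x hst) f)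
  have hentry : (twoPointMatrix x s t 0 0).re = x := Complex.ofReal_re x
  simp only [Matrix.smul_apply, Matrix.add_apply, Matrix.one_apply_eq, Complex.add_re,
    Complex.smul_re, Complex.one_re, hentry, smul_eq_mul] at h
  linear_combination h

lemma half_smul_twoPointMatrix_add (x : ℝ) {s t : ℝ} :
    (1 / 2 : ℝ) • twoPointMatrix x s t + (1 - 1 / 2 : ℝ) • twoPointMatrix x t s =
      twoPointMatrix x √(s * t) √(s * t) := by
  ext i j
  fin_cases i <;> fin_cases j <;>
    simp [twoPointMatrix, mul_comm t s, Real.sqrt_mul_self (Real.sqrt_nonneg _)] <;> ring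

/-- The symmetric second difference of `f` at `x` with step `δ`. Matrix convexity of order two makes
it convex both in `δ ^ 2` and in `x`. -/
def secondDiff (f : ℝ → ℝ) (δ x : ℝ) : ℝ := f (x + δ) + f (x - δ) - 2 * f x

lemma MatrixConvexOn.secondDiff_sqrt_mul_le {I : Set ℝ} {f : ℝ → ℝ} (h : MatrixConvexOn 2 I f)
    {x s t : ℝ} (hs : 0 < s) (ht : 0 < t) (hsI : x + s ∈ I ∧ x - s ∈ I)
    (htI : x + t ∈ I ∧ x - t ∈ I) :
    (s + t) * secondDiff f √(s * t) x ≤ t * secondDiff f s x + s * secondDiff f t x := by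
  have hst : 0 ≤ s * t := (mul_pos hs ht).le
  have hts : 0 ≤ t * s := (mul_pos ht hs).le
  have hq : 0 < √(s * t) := Real.sqrt_pos.mpr (mul_pos hs ht)
  have hmean := h.re_cfc_apply_self_le (isHermitian_twoPointMatrix x s t)
    (isHermitian_twoPointMatrix x t s)
    ((spectrum_twoPointMatrix_subset x hst).trans (pair_subset htI.2 hsI.1))
    ((spectrum_twoPointMatrix_subset x hts).trans (pair_subset hsI.2 htI.1))
    (c := 1 / 2) (by norm_num) (by norm_num) 0
  rw [half_smul_twoPointMatrix_add] at hmean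
  have hmid := re_cfc_twoPointMatrix f x (mul_self_nonneg √(s * t))
  have hstEntry := re_cfc_twoPointMatrix f x hst
  have htsEntry := re_cfc_twoPointMatrix f x hts
  have hmid' : f (x + √(s * t)) + f (x - √(s * t)) =
      2 * (cfc f (twoPointMatrix x √(s * t) √(s * t)) 0 0).re :=
    mul_left_cancel₀ hq.ne' (by linear_combination -hmid)
  unfold secondDiff
  nlinarith [mul_le_mul_of_nonneg_left hmean (add_pos hs ht).le]

end TwoPointMatrix

section ConvexityCriteria

lemma convexOn_of_forall_le_chord {s : Set ℝ} (hs : Convex ℝ s) {F : ℝ → ℝ}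
    (h : ∀ x ∈ s, ∀ y ∈ s, ∀ z ∈ Ioo x y, ∀ m : ℝ, F x + m * (y - x) = F y →
      F z ≤ F x + m * (z - x)) : ConvexOn ℝ s F := by
  refine LinearOrder.convexOn_of_lt hs fun x hx y hy hxy a b ha hb hab => ?_
  obtain rfl : a = 1 - b := by linarith
  have hyx : y - x ≠ 0 := by linarith
  have hz : (1 - b) • x + b • y = x + b * (y - x) := by simp only [smul_eq_mul]; ring
  have hzmem : x + b * (y - x) ∈ Ioo x y := ⟨by nlinarith, by nlinarith⟩
  have := h x hx y hy _ hzmem ((F y - F x) / (y - x)) (by field_simp; ring)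
  rw [hz]
  refine this.trans_eq ?_
  simp only [smul_eq_mul]
  field_simp
  ring

lemma exists_pos_on_Ioo_of_pos {G : ℝ → ℝ} {x y z : ℝ} (hG : ContinuousOn G (Icc x y))
    (hz : z ∈ Icc x y) (hx : G x ≤ 0) (hy : G y ≤ 0) (hGz : 0 < G z) :
    ∃ a ∈ Icc x y, ∃ b ∈ Icc x y, a < b ∧ G a ≤ 0 ∧ G b ≤ 0 ∧ ∀ t ∈ Ioo a b, 0 < G t := by
  have hle {u v : ℝ} (hu : x ≤ u) (hv : v ≤ y) : IsCompact {t ∈ Icc u v | G t ≤ 0} :=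
    isCompact_Icc.of_isClosed_subset
      ((hG.mono (Icc_subset_Icc hu hv)).preimage_isClosed_of_isClosed isClosed_Icc isClosed_Iic)
      fun t ht => ht.1
  obtain ⟨a, ⟨ha, hGa⟩, hamax⟩ :=
    (hle le_rfl hz.2).exists_isGreatest ⟨x, ⟨le_rfl, hz.1⟩, hx⟩
  obtain ⟨b, ⟨hb, hGb⟩, hbmin⟩ :=
    (hle hz.1 le_rfl).exists_isLeast ⟨y, ⟨hz.2, le_rfl⟩, hy⟩
  have haz : a < z := ha.2.lt_of_ne (by rintro rfl; exact hGz.not_ge hGa)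
  have hzb : z < b := hb.1.lt_of_ne (by rintro rfl; exact hGz.not_ge hGb)
  refine ⟨a, ⟨ha.1, ha.2.trans hz.2⟩, b, ⟨hz.1.trans hb.1, hb.2⟩, haz.trans hzb, hGa, hGb,
    fun t ht => ?_⟩
  by_contra! hGt
  rcases le_total t z with htz | hzt
  · exact ht.1.not_ge (hamax ⟨⟨ha.1.trans ht.1.le, htz⟩, hGt⟩)
  · exact ht.2.not_ge (hbmin ⟨⟨hzt, ht.2.le.trans hb.2⟩, hGt⟩)

lemma convexOn_of_exists_le_chord {s : Set ℝ} (hs : Convex ℝ s) {F : ℝ → ℝ}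
    (hF : ContinuousOn F s) (h : ∀ a ∈ s, ∀ b ∈ s, a < b → ∃ t ∈ Ioo (0 : ℝ) 1,
      F ((1 - t) * a + t * b) ≤ (1 - t) * F a + t * F b) : ConvexOn ℝ s F := by
  refine convexOn_of_forall_le_chord hs fun x hx y hy z hz m hm => ?_
  have hsub : Icc x y ⊆ s := hs.ordConnected.out hx hy
  by_contra! hpos
  obtain ⟨a, ha, b, hb, hab, hGa, hGb, hG⟩ := exists_pos_on_Ioo_of_pos
    (G := fun t => F t - (F x + m * (t - x))) ((hF.mono hsub).sub (by fun_prop))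
    (Ioo_subset_Icc_self hz) (by simp) (by simp [hm]) (sub_pos.mpr hpos)
  obtain ⟨t, ⟨ht₀, ht₁⟩, ht⟩ := h a (hsub ha) b (hsub hb) hab
  have := hG ((1 - t) * a + t * b) ⟨by nlinarith, by nlinarith⟩
  nlinarith

lemma convexOn_closure {s : Set ℝ} {F : ℝ → ℝ} (h : ConvexOn ℝ s F)
    (hF : ContinuousOn F (closure s)) : ConvexOn ℝ (closure s) F := by
  refine ⟨h.1.closure, fun x hx y hy a b ha hb hab => ?_⟩
  have hfst : ContinuousOn (fun p : ℝ × ℝ => F p.1) (closure s ×ˢ closure s) :=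
    hF.comp continuousOn_fst fun p hp => hp.1
  have hsnd : ContinuousOn (fun p : ℝ × ℝ => F p.2) (closure s ×ˢ closure s) :=
    hF.comp continuousOn_snd fun p hp => hp.2
  have hcomb : ContinuousOn (fun p : ℝ × ℝ => F (a • p.1 + b • p.2)) (closure s ×ˢ closure s) :=
    hF.comp (by fun_prop) fun p hp => h.1.closure hp.1 hp.2 ha hb hab
  have hmem : (x, y) ∈ closure (s ×ˢ s) := by
    rw [closure_prod_eq]
    exact ⟨hx, hy⟩
  rw [← closure_prod_eq] at hfst hsnd hcomb
  exact ContinuousWithinAt.closure_le (f := fun p : ℝ × ℝ => F (a • p.1 + b • p.2)) hmem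
    ((hcomb _ hmem).mono subset_closure)
    (((hfst.const_smul a).add (hsnd.const_smul b) _ hmem).mono subset_closure)
    fun p hp => h.2 hp.1 hp.2 ha hb hab

lemma convexOn_of_tendsto {α : Type*} {l : Filter α} [l.NeBot] {s : Set ℝ} (hs : Convex ℝ s)
    {u : α → Set ℝ} (hu : ∀ x ∈ s, ∀ᶠ i in l, x ∈ u i) {F : α → ℝ → ℝ} {G : ℝ → ℝ}
    (hconv : ∀ᶠ i in l, ConvexOn ℝ (u i) (F i))
    (hlim : ∀ x ∈ s, Tendsto (fun i => F i x) l (𝓝 (G x))) :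
    ConvexOn ℝ s G := by
  refine ⟨hs, fun x hx y hy a b ha hb hab => ?_⟩
  refine le_of_tendsto_of_tendsto (hlim _ (hs hx hy ha hb hab))
    (((hlim x hx).const_smul a).add ((hlim y hy).const_smul b)) ?_
  filter_upwards [hu x hx, hu y hy, hconv] with i hxi hyi hi
  exact hi.2 hxi hyi ha hb hab

lemma secondDiff_nonneg_of_convexOn {s : Set ℝ} {F : ℝ → ℝ} (hF : ConvexOn ℝ s F) {δ x : ℝ}
    (h₁ : x + δ ∈ s) (h₂ : x - δ ∈ s) : 0 ≤ secondDiff F δ x := by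
  have := hF.2 h₁ h₂ (by norm_num : (0 : ℝ) ≤ 1 / 2) (by norm_num : (0 : ℝ) ≤ 1 / 2) (by norm_num)
  simp only [smul_eq_mul] at this
  rw [show 1 / 2 * (x + δ) + 1 / 2 * (x - δ) = x by ring] at this
  unfold secondDiff
  linarith

lemma convexOn_of_frequently_secondDiff_pos {s : Set ℝ} (hs : Convex ℝ s) {F : ℝ → ℝ}
    (hF : ContinuousOn F s) (h : ∀ x ∈ s, ∃ᶠ η in 𝓝[>] (0 : ℝ), 0 < secondDiff F η x) :
    ConvexOn ℝ s F := by
  refine convexOn_of_forall_le_chord hs fun x hx y hy z hz m hm => ?_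
  have hsub : Icc x y ⊆ s := hs.ordConnected.out hx hy
  have hG : ContinuousOn (fun t => F t - (F x + m * (t - x))) (Icc x y) :=
    (hF.mono hsub).sub (by fun_prop)
  obtain ⟨c, hc, hmax⟩ := isCompact_Icc.exists_isMaxOn ⟨z, Ioo_subset_Icc_self hz⟩ hG
  simp only [isMaxOn_iff] at hmax
  have hzc := hmax z (Ioo_subset_Icc_self hz)
  by_contra! hpos
  have hxc : x < c := hc.1.lt_of_ne (by rintro rfl; linarith)
  have hcy : c < y := hc.2.lt_of_ne (by rintro rfl; linarith)
  have hsmall : ∀ᶠ η in 𝓝[>] (0 : ℝ), η ∈ Ioo 0 (min (c - x) (y - c)) :=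
    Ioo_mem_nhdsGT (lt_min (by linarith) (by linarith))
  obtain ⟨η, hη, hη₀, hηmin⟩ := ((h c (hsub hc)).and_eventually hsmall).exists
  obtain ⟨hηx, hηy⟩ := lt_min_iff.mp hηmin
  have hright := hmax (c + η) ⟨by linarith, by linarith⟩
  have hleft := hmax (c - η) ⟨by linarith, by linarith⟩
  unfold secondDiff at hη
  linarith

lemma convexOn_of_tendsto_secondDiff_div {s : Set ℝ} (hs : Convex ℝ s) {F w : ℝ → ℝ}
    (hF : ContinuousOn F s)
    (hlim : ∀ x ∈ s, Tendsto (fun η => secondDiff F η x / η ^ 2) (𝓝[>] 0) (𝓝 (w x)))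
    (hw : ∀ x ∈ s, 0 ≤ w x) : ConvexOn ℝ s F := by
  have hpert : ∀ ε > 0, ConvexOn ℝ s fun t => F t + ε * t ^ 2 := by
    intro ε hε
    refine convexOn_of_frequently_secondDiff_pos hs (hF.add (by fun_prop)) fun x hx => ?_
    refine Eventually.frequently ?_
    filter_upwards [(hlim x hx).eventually (lt_mem_nhds (by linarith [hw x hx] : -ε < w x)),
      self_mem_nhdsWithin] with η hη hη₀
    have hη₂ : 0 < η ^ 2 := pow_pos hη₀ 2
    rw [lt_div_iff₀ hη₂] at hη
    unfold secondDiff at hη ⊢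
    nlinarith
  refine convexOn_of_tendsto (l := 𝓝[>] (0 : ℝ)) hs (fun x hx => Eventually.of_forall fun _ => hx)
    (eventually_mem_nhdsWithin.mono hpert) fun x _ => ?_
  exact (Continuous.tendsto' (by fun_prop) _ _ (by simp)).mono_left nhdsWithin_le_nhds

end ConvexityCriteria

section FourthDifference

variable {I : Set ℝ} {f : ℝ → ℝ}

lemma secondDiff_sqrt_sq (f : ℝ → ℝ) (δ x : ℝ) : secondDiff f √(δ ^ 2) x = secondDiff f δ x := by
  rw [Real.sqrt_sq_eq_abs]
  unfold secondDiff
  rcases abs_choice δ with h | h <;> rw [h]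
  ring_nf

lemma secondDiff_secondDiff (f : ℝ → ℝ) (δ κ x : ℝ) :
    secondDiff (secondDiff f δ) κ x = secondDiff f (δ + κ) x + secondDiff f (δ - κ) x -
      2 * secondDiff f δ x - 2 * secondDiff f κ x := by
  unfold secondDiff
  ring_nf

lemma continuousOn_secondDiff {δ : ℝ} (hI : Convex ℝ I) (hf : ContinuousOn f I) :
    ContinuousOn (secondDiff f δ) {x | x + δ ∈ I ∧ x - δ ∈ I} := by
  have hmid (x : ℝ) (hx : x + δ ∈ I ∧ x - δ ∈ I) : x ∈ I := by
    rcases le_total 0 δ with h | h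
    · exact hI.ordConnected.out hx.2 hx.1 ⟨by linarith, by linarith⟩
    · exact hI.ordConnected.out hx.1 hx.2 ⟨by linarith, by linarith⟩
  exact ((hf.comp (by fun_prop) fun x hx => hx.1).add
    (hf.comp (by fun_prop) fun x hx => hx.2)).sub ((hf.mono hmid).const_mul 2)

lemma add_mem_and_sub_mem_of_abs_le (hI : Convex ℝ I) {x δ r : ℝ} (h : |δ| ≤ r)
    (hr : x + r ∈ I ∧ x - r ∈ I) : x + δ ∈ I ∧ x - δ ∈ I := by
  obtain ⟨hneg, hpos⟩ := abs_le.mp h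
  exact ⟨hI.ordConnected.out hr.2 hr.1 ⟨by linarith, by linarith⟩,
    hI.ordConnected.out hr.2 hr.1 ⟨by linarith, by linarith⟩⟩

lemma MatrixConvexOn.convexOn_secondDiff_sqrt (hI : IsOpen I) (hc : Convex ℝ I)
    (h : MatrixConvexOn 2 I f) {x r : ℝ} (hr₀ : 0 < r) (hr : x + r ∈ I ∧ x - r ∈ I) :
    ConvexOn ℝ (Icc 0 (r ^ 2)) fun u => secondDiff f √u x := by
  have hf : ContinuousOn f I := (h.convexOn hc).continuousOn hI
  have hmem (u : ℝ) (hu : u ∈ Icc 0 (r ^ 2)) : x + √u ∈ I ∧ x - √u ∈ I :=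
    add_mem_and_sub_mem_of_abs_le hc
      ((abs_of_nonneg (Real.sqrt_nonneg u)).trans_le (Real.sqrt_le_iff.mpr ⟨hr₀.le, hu.2⟩)) hr
  have hcont : ContinuousOn (fun u => secondDiff f √u x) (Icc 0 (r ^ 2)) :=
    ((hf.comp (by fun_prop) fun u hu => (hmem u hu).1).add
      (hf.comp (by fun_prop) fun u hu => (hmem u hu).2)).sub continuousOn_const
  rw [← closure_Ioo (by positivity)] at hcont hmem ⊢
  refine convexOn_closure (convexOn_of_exists_le_chord (convex_Ioo _ _)
    (hcont.mono subset_closure) fun a ha b hb _ => ?_) hcont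
  have hs : 0 < √a := Real.sqrt_pos.mpr ha.1
  have ht : 0 < √b := Real.sqrt_pos.mpr hb.1
  have hineq := h.secondDiff_sqrt_mul_le hs ht (hmem a (subset_closure ha))
    (hmem b (subset_closure hb))
  have hst : 0 < √a + √b := add_pos hs ht
  have hweight : 1 - √a / (√a + √b) = √b / (√a + √b) := by
    field_simp
    ring
  have hmean : √b / (√a + √b) * a + √a / (√a + √b) * b = √a * √b := by
    field_simp
    nlinarith [Real.sq_sqrt ha.1.le, Real.sq_sqrt hb.1.le]
  refine ⟨√a / (√a + √b), ⟨div_pos hs hst, (div_lt_one hst).mpr (by linarith)⟩, ?_⟩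
  rw [hweight, hmean, div_mul_eq_mul_div, div_mul_eq_mul_div, ← add_div, le_div_iff₀ hst, mul_comm]
  exact hineq

lemma add_le_map_add_of_convexOn {H : ℝ → ℝ} {R : ℝ} (hH : ConvexOn ℝ (Icc 0 R) H)
    (hH₀ : H 0 = 0) {a b : ℝ} (ha : 0 < a) (hb : 0 < b) (hab : a + b ≤ R) :
    H a + H b ≤ H (a + b) := by
  have h₀ : (0 : ℝ) ∈ Icc 0 R := ⟨le_rfl, by linarith⟩
  have hsum : a + b ∈ Icc 0 R := ⟨by linarith, hab⟩
  have hleft := hH.secant_mono_aux1 h₀ hsum ha (lt_add_of_pos_right a hb)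
  have hright := hH.secant_mono_aux1 h₀ hsum hb (lt_add_of_pos_left b ha)
  rw [hH₀] at hleft hright
  exact le_of_mul_le_mul_left (by linarith) (add_pos ha hb)

lemma MatrixConvexOn.secondDiff_secondDiff_nonneg (hI : IsOpen I) (hc : Convex ℝ I)
    (h : MatrixConvexOn 2 I f) {x δ κ : ℝ} (hδ : 0 < δ) (hκ : 0 < κ)
    (hx : x + (δ + κ) ∈ I ∧ x - (δ + κ) ∈ I) : 0 ≤ secondDiff (secondDiff f δ) κ x := by
  have hconv := h.convexOn_secondDiff_sqrt hI hc (add_pos hδ hκ) hx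
  have hsq : δ ^ 2 + κ ^ 2 ≤ (δ + κ) ^ 2 := by nlinarith
  have hsuper := add_le_map_add_of_convexOn hconv (by simp [secondDiff, two_mul]) (pow_pos hδ 2)
    (pow_pos hκ 2) hsq
  have hmean := hconv.2 (x := (δ + κ) ^ 2) (y := (δ - κ) ^ 2) ⟨by positivity, le_rfl⟩
    ⟨by positivity, by nlinarith⟩ (by norm_num : (0 : ℝ) ≤ 1 / 2) (by norm_num : (0 : ℝ) ≤ 1 / 2)
    (by norm_num)
  simp only [smul_eq_mul] at hmean
  rw [show 1 / 2 * (δ + κ) ^ 2 + 1 / 2 * (δ - κ) ^ 2 = δ ^ 2 + κ ^ 2 by ring] at hmean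
  simp only [secondDiff_sqrt_sq] at hsuper hmean
  rw [secondDiff_secondDiff]
  linarith

lemma MatrixConvexOn.convexOn_secondDiff (hI : IsOpen I) (hc : Convex ℝ I)
    (h : MatrixConvexOn 2 I f) {δ : ℝ} (hδ : 0 < δ) :
    ConvexOn ℝ {x | x + δ ∈ I ∧ x - δ ∈ I} (secondDiff f δ) := by
  have hs : Convex ℝ {x | x + δ ∈ I ∧ x - δ ∈ I} :=
    (hc.translate_preimage_left δ).inter (hc.translate_preimage_left (-δ))
  refine convexOn_of_exists_le_chord hs
    (continuousOn_secondDiff hc ((h.convexOn hc).continuousOn hI)) fun a ha b hb hab =>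
      ⟨1 / 2, ⟨by norm_num, by norm_num⟩, ?_⟩
  obtain ⟨κ, rfl⟩ : ∃ κ, b = a + 2 * κ := ⟨(b - a) / 2, by ring⟩
  have := h.secondDiff_secondDiff_nonneg hI hc (x := a + κ) hδ (by linarith : 0 < κ)
    ⟨by convert hb.1 using 1; ring, by convert ha.2 using 1; ring⟩
  rw [secondDiff, show a + κ + κ = a + 2 * κ by ring, add_sub_cancel_right] at this
  rw [show (1 - 1 / 2) * a + 1 / 2 * (a + 2 * κ) = a + κ by ring]
  linarith

end FourthDifference

section SecondDerivative

variable {I : Set ℝ} {f : ℝ → ℝ}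

lemma tendsto_symm_diffQuot {f' x : ℝ} (hf : HasDerivAt f f' x) :
    Tendsto (fun η => (f (x + η) - f (x - η)) / (2 * η)) (𝓝[>] 0) (𝓝 f') := by
  have hodd : HasDerivAt (fun η => f (x + η) - f (x - η)) (f' - -f') 0 := by
    refine HasDerivAt.sub (HasDerivAt.comp_const_add x 0 ?_) (HasDerivAt.comp_const_sub x 0 ?_)
    · rwa [add_zero]
    · rwa [sub_zero]
  have hlim := (tendsto_diffQuot hodd).div_const 2
  rw [sub_neg_eq_add, ← two_mul, mul_div_cancel_left₀ _ two_ne_zero] at hlim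
  refine hlim.congr fun η => ?_
  rw [diffQuot, zero_add, add_zero, sub_zero, sub_self, sub_zero, div_div, mul_comm]

lemma tendsto_secondDiff_div {g : ℝ → ℝ} {w x : ℝ} (hf : ∀ᶠ y in 𝓝 x, HasDerivAt f (g y) y)
    (hg : HasDerivAt g w x) : Tendsto (fun η => secondDiff f η x / η ^ 2) (𝓝[>] 0) (𝓝 w) := by
  have hp : Tendsto (fun η : ℝ => x + η) (𝓝[>] 0) (𝓝 x) :=
    (Continuous.tendsto' (by fun_prop) _ _ (add_zero x)).mono_left nhdsWithin_le_nhds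
  have hm : Tendsto (fun η : ℝ => x - η) (𝓝[>] 0) (𝓝 x) :=
    (Continuous.tendsto' (by fun_prop) _ _ (sub_zero x)).mono_left nhdsWithin_le_nhds
  have hfx : Tendsto f (𝓝 x) (𝓝 (f x)) := hf.self_of_nhds.continuousAt
  have hnum : Tendsto (fun η => secondDiff f η x) (𝓝[>] 0) (𝓝 0) := by
    have := ((hfx.comp hp).add (hfx.comp hm)).sub_const (2 * f x)
    rwa [← two_mul, sub_self] at this
  have hden : Tendsto (fun η : ℝ => η ^ 2) (𝓝[>] 0) (𝓝 0) :=
    (Continuous.tendsto' (by fun_prop) _ _ (by simp)).mono_left nhdsWithin_le_nhds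
  refine HasDerivAt.lhopital_zero_nhdsGT (f' := fun η => g (x + η) - g (x - η))
    (g' := fun η => 2 * η) ?_ ?_ ?_ hnum hden (tendsto_symm_diffQuot hg)
  · filter_upwards [hp.eventually hf, hm.eventually hf] with η h₁ h₂
    exact (((h₁.comp_const_add x η).add (h₂.comp_const_sub x η)).sub_const
      (2 * f x)).congr_deriv (sub_eq_add_neg _ _).symm
  · exact Eventually.of_forall fun η => by simpa using hasDerivAt_pow 2 η
  · filter_upwards [self_mem_nhdsWithin] with η hη
    exact mul_ne_zero two_ne_zero (ne_of_gt hη)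

lemma exists_mem_gt {α : Type*} [LinearOrder α] [TopologicalSpace α] [OrderTopology α]
    [DenselyOrdered α] [NoMaxOrder α] {s : Set α} (hs : IsOpen s) {p : α} (hp : p ∈ s) :
    ∃ q ∈ s, p < q := by
  have hnear : ∀ᶠ q in 𝓝[>] p, q ∈ s := mem_nhdsWithin_of_mem_nhds (hs.mem_nhds hp)
  exact (hnear.and self_mem_nhdsWithin).exists

lemma exists_affine_of_convexOn_of_concaveOn (hI : IsOpen I) (h₁ : ConvexOn ℝ I f)
    (h₂ : ConcaveOn ℝ I f) : ∃ α β : ℝ, ∀ x ∈ I, f x = α * x + β := by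
  rcases I.eq_empty_or_nonempty with rfl | ⟨p, hp⟩
  · exact ⟨0, 0, by simp⟩
  obtain ⟨q, hq, hpq⟩ := exists_mem_gt hI hp
  have hcollinear {x y z : ℝ} (hx : x ∈ I) (hz : z ∈ I) (hxy : x < y) (hyz : y < z) :
      (f y - f x) * (z - y) = (f z - f y) * (y - x) := by
    have := le_antisymm (h₁.slope_mono_adjacent hx hz hxy hyz)
      (h₂.slope_anti_adjacent hx hz hxy hyz)
    rwa [div_eq_div_iff (by linarith) (by linarith)] at this
  have hne : q - p ≠ 0 := by linarith
  have hchord (x : ℝ) (hx : x ∈ I) : (q - p) * (f x - f p) = (f q - f p) * (x - p) := by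
    rcases lt_trichotomy x p with h | rfl | h
    · linear_combination -hcollinear hx hq h hpq
    · ring
    · rcases lt_trichotomy x q with h' | rfl | h'
      · linear_combination hcollinear hp hq h h'
      · ring
      · linear_combination -hcollinear hp hx hpq h'
  refine ⟨(f q - f p) / (q - p), f p - (f q - f p) / (q - p) * p, fun x hx => ?_⟩
  field_simp
  linear_combination hchord x hx

lemma exists_hasDerivAt_of_tendsto_secondDiff_div (hI : IsOpen I) (hc : Convex ℝ I) {w : ℝ → ℝ}
    (hf : ContinuousOn f I) (hw : ContinuousOn w I)
    (hlim : ∀ x ∈ I, Tendsto (fun η => secondDiff f η x / η ^ 2) (𝓝[>] 0) (𝓝 (w x))) :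
    ∃ g : ℝ → ℝ, (∀ x ∈ I, HasDerivAt f (g x) x) ∧ ∀ x ∈ I, HasDerivAt g (w x) x := by
  obtain ⟨G', hG'⟩ := exists_antideriv hI hc hw
  obtain ⟨G, hG⟩ := exists_antideriv hI hc fun x hx => (hG' x hx).continuousAt.continuousWithinAt
  have hGc : ContinuousOn G I := fun x hx => (hG x hx).continuousAt.continuousWithinAt
  have hGlim (x : ℝ) (hx : x ∈ I) := tendsto_secondDiff_div
    (eventually_of_mem (hI.mem_nhds hx) hG) (hG' x hx)
  have hconvex : ConvexOn ℝ I (f - G) := by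
    refine convexOn_of_tendsto_secondDiff_div (w := 0) hc (hf.sub hGc) (fun x hx => ?_)
      fun _ _ => le_rfl
    refine (((hlim x hx).sub (hGlim x hx)).congr fun η => ?_).trans_eq (by simp)
    simp only [secondDiff, Pi.sub_apply]
    ring
  have hconcave : ConvexOn ℝ I (G - f) := by
    refine convexOn_of_tendsto_secondDiff_div (w := 0) hc (hGc.sub hf) (fun x hx => ?_)
      fun _ _ => le_rfl
    refine (((hGlim x hx).sub (hlim x hx)).congr fun η => ?_).trans_eq (by simp)
    simp only [secondDiff, Pi.sub_apply]
    ring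
  obtain ⟨α, β, hαβ⟩ := exists_affine_of_convexOn_of_concaveOn hI hconvex
    (neg_sub G f ▸ hconcave.neg)
  refine ⟨fun x => G' x + α, fun x hx => ?_, fun x hx => (hG' x hx).add_const α⟩
  have hsum : HasDerivAt (fun t => G t + (α * t + β)) (G' x + α) x :=
    (hG x hx).add (((hasDerivAt_id x).const_mul α).add_const β |>.congr_deriv (mul_one α))
  refine hsum.congr_of_eventuallyEq ?_
  filter_upwards [hI.mem_nhds hx] with t ht
  rw [← hαβ t ht, Pi.sub_apply, add_sub_cancel]

lemma exists_tendsto_div_of_convexOn {H : ℝ → ℝ} {R : ℝ} (hR : 0 < R)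
    (hH : ConvexOn ℝ (Icc 0 R) H) (hH₀ : H 0 = 0) (hpos : ∀ u ∈ Icc 0 R, 0 ≤ H u) :
    ∃ l, Tendsto (fun u => H u / u) (𝓝[>] 0) (𝓝 l) := by
  have hmono : MonotoneOn (fun u => H u / u) (Ioo 0 R) := fun u hu v hv huv => by
    simpa only [hH₀, sub_zero] using hH.secant_mono (left_mem_Icc.mpr hR.le)
      (Ioo_subset_Icc_self hu) (Ioo_subset_Icc_self hv) hu.1.ne' hv.1.ne' huv
  refine ⟨_, hmono.tendsto_nhdsWithin_Ioo_right (nonempty_Ioo.mpr hR) ⟨0, ?_⟩⟩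
  rintro _ ⟨u, hu, rfl⟩
  exact div_nonneg (hpos u (Ioo_subset_Icc_self hu)) hu.1.le

lemma eventually_add_mem_and_sub_mem (hI : IsOpen I) {x : ℝ} (hx : x ∈ I) :
    ∀ᶠ η in 𝓝[>] (0 : ℝ), x + η ∈ I ∧ x - η ∈ I := by
  have hsub : ∀ᶠ η in 𝓝 (0 : ℝ), x - η ∈ I :=
    (continuous_sub_left x).continuousAt.eventually_mem (hI.mem_nhds (by rwa [sub_zero]))
  exact nhdsWithin_le_nhds ((eventually_add_mem hI hx).and hsub)

lemma MatrixConvexOn.exists_tendsto_secondDiff_div (hI : IsOpen I) (hc : Convex ℝ I)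
    (h : MatrixConvexOn 2 I f) {x : ℝ} (hx : x ∈ I) :
    ∃ l, Tendsto (fun η => secondDiff f η x / η ^ 2) (𝓝[>] 0) (𝓝 l) := by
  obtain ⟨r, hr, hr₀⟩ := ((eventually_add_mem_and_sub_mem hI hx).and self_mem_nhdsWithin).exists
  have hr₀ : 0 < r := hr₀
  obtain ⟨l, hl⟩ := exists_tendsto_div_of_convexOn (pow_pos hr₀ 2)
    (h.convexOn_secondDiff_sqrt hI hc hr₀ hr) (by simp [secondDiff, two_mul]) fun u hu => by
      obtain ⟨h₁, h₂⟩ := add_mem_and_sub_mem_of_abs_le hc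
        ((abs_of_nonneg (Real.sqrt_nonneg u)).trans_le (Real.sqrt_le_iff.mpr ⟨hr₀.le, hu.2⟩)) hr
      exact secondDiff_nonneg_of_convexOn (h.convexOn hc) h₁ h₂
  have hsq : Tendsto (fun η : ℝ => η ^ 2) (𝓝[>] 0) (𝓝[>] 0) :=
    tendsto_nhdsWithin_iff.mpr
      ⟨(Continuous.tendsto' (by fun_prop) _ _ (by simp)).mono_left nhdsWithin_le_nhds,
        eventually_mem_nhdsWithin.mono fun η hη => (pow_pos hη 2 : (0 : ℝ) < η ^ 2)⟩
  exact ⟨l, (hl.comp hsq).congr fun η => by rw [Function.comp_apply, secondDiff_sqrt_sq]⟩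

lemma MatrixConvexOn.exists_convexOn_tendsto_secondDiff_div (hI : IsOpen I) (hc : Convex ℝ I)
    (h : MatrixConvexOn 2 I f) : ∃ w : ℝ → ℝ, ConvexOn ℝ I w ∧
      ∀ x ∈ I, Tendsto (fun η => secondDiff f η x / η ^ 2) (𝓝[>] 0) (𝓝 (w x)) := by
  choose! w hw using fun x (hx : x ∈ I) => h.exists_tendsto_secondDiff_div hI hc hx
  refine ⟨w, convexOn_of_tendsto (u := fun η => {x | x + η ∈ I ∧ x - η ∈ I}) hc
    (fun x hx => eventually_add_mem_and_sub_mem hI hx)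
    (eventually_mem_nhdsWithin.mono fun η hη => ?_) hw, hw⟩
  simpa only [div_eq_inv_mul, smul_eq_mul] using
    (h.convexOn_secondDiff hI hc hη).smul (inv_nonneg.mpr (sq_nonneg η))

end SecondDerivative

section ClassQTwo

variable {I : Set ℝ} {g w : ℝ → ℝ}

lemma sub_le_of_convexOn_deriv (hg : ∀ x ∈ I, HasDerivAt g (w x) x) (hw : ConvexOn ℝ I w)
    {s t : ℝ} (hs : s ∈ I) (ht : t ∈ I) (hst : s < t) :
    g t - g s ≤ (w s + w t) / 2 * (t - s) := by
  have hsub : Icc s t ⊆ I := hw.1.ordConnected.out hs ht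
  have hts : 0 < t - s := sub_pos.mpr hst
  -- The derivative is `t - s` times the gap between the chord of `w` over `[s, t]` and `w`.
  have hderiv (x : ℝ) (hx : x ∈ I) :
      HasDerivAt (fun x => (x - s) ^ 2 / 2 * w t - (t - x) ^ 2 / 2 * w s - (t - s) * g x)
        ((x - s) * w t + (t - x) * w s - (t - s) * w x) x := by
    have hsx : HasDerivAt (fun x => x - s) 1 x := (hasDerivAt_id x).sub_const s
    have htx : HasDerivAt (fun x => t - x) (-1) x := (hasDerivAt_id x).const_sub t
    refine (((((hsx.pow 2).div_const 2).mul_const (w t)).sub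
      (((htx.pow 2).div_const 2).mul_const (w s))).sub ((hg x hx).const_mul _)).congr_deriv ?_
    norm_num
    ring
  have hmono := monotoneOn_of_hasDerivWithinAt_nonneg (convex_Icc s t)
    (fun x hx => (hderiv x (hsub hx)).continuousAt.continuousWithinAt)
    (fun x hx => (hderiv x (hsub (interior_subset hx))).hasDerivWithinAt) fun x hx => by
      rw [interior_Icc] at hx
      linarith [hw.secant_mono_aux1 hs ht hx.1 hx.2]
  have hends := hmono (left_mem_Icc.mpr hst.le) (right_mem_Icc.mpr hst.le) hst.le
  refine le_of_mul_le_mul_left ?_ hts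
  dsimp only at hends
  linarith

lemma two_mul_dslope_le_add_of_convexOn_deriv (hg : ∀ x ∈ I, HasDerivAt g (w x) x)
    (hw : ConvexOn ℝ I w) {s t : ℝ} (hs : s ∈ I) (ht : t ∈ I) :
    2 * dslope g s t ≤ w s + w t := by
  wlog hst : s ≤ t generalizing s t
  · rw [dslope_comm, add_comm]
    exact this ht hs (not_le.mp hst).le
  rcases hst.eq_or_lt with rfl | hst
  · rw [dslope_same, (hg s hs).deriv, two_mul]
  · have := sub_le_of_convexOn_deriv hg hw hs ht hst
    rw [← dslope_mul_sub] at this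
    linarith [le_of_mul_le_mul_right this (sub_pos.mpr hst)]

lemma isHermitian_loewnerMatrix {n : ℕ} (f : ℝ → ℝ) (l : Fin n → ℝ) :
    (loewnerMatrix f l).IsHermitian := by
  ext i j
  simp only [loewnerMatrix, Matrix.conjTranspose_apply, Matrix.of_apply, Complex.star_def,
    Complex.conj_ofReal, dslope_comm f (l j) (l i)]

lemma condPosDef_of_nonneg {A : Matrix (Fin 2) (Fin 2) ℂ} (hA : A.IsHermitian)
    (h : 0 ≤ A 0 0 + A 1 1 - A 0 1 - A 1 0) : CondPosDef A := by
  refine ⟨hA, fun x hx => ?_⟩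
  rw [Fin.sum_univ_two, add_comm, ← eq_neg_iff_add_eq_zero] at hx
  refine (mul_nonneg (star_mul_self_nonneg (x 0)) h).trans_eq ?_
  simp only [dotProduct, Matrix.mulVec, Fin.sum_univ_two, Pi.star_apply, hx, star_neg]
  ring

lemma mem_classQ_two_of_convexOn (hI : IsOpen I) (hg : ∀ x ∈ I, HasDerivAt g (w x) x)
    (hw : ConvexOn ℝ I w) : g ∈ ClassQ 2 I := by
  refine ⟨(contDiffOn_succ_iff_deriv_of_isOpen (n := 0) hI).mpr
    ⟨fun x hx => (hg x hx).differentiableAt.differentiableWithinAt, by simp,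
      contDiffOn_zero.mpr ((hw.continuousOn hI).congr fun x hx => (hg x hx).deriv)⟩, fun l hl => ?_⟩
  refine condPosDef_of_nonneg (isHermitian_loewnerMatrix g l) ?_
  have := two_mul_dslope_le_add_of_convexOn_deriv hg hw (hl 0) (hl 1)
  simp only [loewnerMatrix, Matrix.of_apply, dslope_same, (hg _ (hl _)).deriv,
    dslope_comm g (l 1) (l 0)]
  exact_mod_cast (by linarith :
    0 ≤ w (l 0) + w (l 1) - dslope g (l 0) (l 1) - dslope g (l 0) (l 1))

lemma MatrixConvexOn.deriv_mem_classQ {f : ℝ → ℝ} (hI : IsOpen I) (hc : Convex ℝ I)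
    (h : MatrixConvexOn 2 I f) : DifferentiableOn ℝ f I ∧ deriv f ∈ ClassQ 2 I := by
  obtain ⟨w, hw, hlim⟩ := h.exists_convexOn_tendsto_secondDiff_div hI hc
  obtain ⟨g, hg, hgw⟩ := exists_hasDerivAt_of_tendsto_secondDiff_div hI hc
    ((h.convexOn hc).continuousOn hI) (hw.continuousOn hI) hlim
  have hderiv {x : ℝ} (hx : x ∈ I) : deriv f =ᶠ[𝓝 x] g := by
    filter_upwards [hI.mem_nhds hx] with t ht
    exact (hg t ht).deriv
  exact ⟨fun x hx => (hg x hx).differentiableAt.differentiableWithinAt,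
    mem_classQ_two_of_convexOn hI
      (fun x hx => (hgw x hx).congr_of_eventuallyEq (hderiv hx)) hw⟩

end ClassQTwo

section ExponentialPrimitive

lemma exp_mul_exp_mul_sq_lt {p q : ℝ} (h : p < q) :
    Real.exp p * Real.exp q * (q - p) ^ 2 < (Real.exp q - Real.exp p) ^ 2 := by
  set u := (q - p) / 2 with hu
  have hmid : Real.exp p * Real.exp q = Real.exp ((p + q) / 2) ^ 2 := by
    rw [← Real.exp_add, ← Real.exp_nat_mul]
    ring_nf
  have hsub : Real.exp q - Real.exp p = Real.exp ((p + q) / 2) * (2 * Real.sinh u) := by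
    rw [Real.sinh_eq, mul_div_cancel₀ _ two_ne_zero, mul_sub, ← Real.exp_add, ← Real.exp_add, hu]
    ring_nf
  have hpos : 0 < u := by linarith
  have hsinh : q - p < 2 * Real.sinh u := by linarith [Real.self_lt_sinh_iff.mpr hpos]
  rw [hmid, hsub, mul_pow]
  exact mul_lt_mul_of_pos_left (pow_lt_pow_left₀ hsinh (by linarith) two_ne_zero)
    (pow_pos (Real.exp_pos _) 2)

variable {I : Set ℝ} {f : ℝ → ℝ}

lemma MatrixMonotoneOn.dslope_sq_le (h : MatrixMonotoneOn 2 I f) (hI : IsOpen I) {p q f'p f'q : ℝ}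
    (hp : p ∈ I) (hq : q ∈ I) (hfp : HasDerivAt f f'p p) (hfq : HasDerivAt f f'q q) :
    dslope f p q ^ 2 ≤ f'p * f'q := by
  have hdet := (h.posSemidef_loewnerMatrix (l := ![p, q]) hI (by simp [Fin.forall_fin_two, hp, hq])
    (by simp [Fin.forall_fin_two, hfp.differentiableAt, hfq.differentiableAt])).det_nonneg
  simp only [Matrix.det_fin_two, loewnerMatrix, Matrix.of_apply, Matrix.cons_val_zero,
    Matrix.cons_val_one, dslope_same, hfp.deriv, hfq.deriv, dslope_comm f q p] at hdet
  norm_cast at hdet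
  linarith

lemma not_matrixMonotoneOn_of_hasDerivAt_exp (hI : IsOpen I) (hc : Convex ℝ I) (hne : I.Nonempty)
    (hf : ∀ t ∈ I, HasDerivAt f (Real.exp t) t) : ¬ MatrixMonotoneOn 2 I f := by
  intro h
  obtain ⟨p, hp⟩ := hne
  obtain ⟨q, hq, hpq⟩ := exists_mem_gt hI hp
  have hdiff : f q - f p = Real.exp q - Real.exp p := by
    have hconst := hI.is_const_of_deriv_eq_zero (f := f - Real.exp) hc.isPreconnected
      (fun t ht => ((hf t ht).sub (Real.hasDerivAt_exp t)).differentiableAt.differentiableWithinAt)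
      (fun t ht => ((hf t ht).sub (Real.hasDerivAt_exp t)).deriv.trans (sub_self _)) hp hq
    simp only [Pi.sub_apply] at hconst
    linarith
  have hle := h.dslope_sq_le hI hp hq (hf p hp) (hf q hq)
  refine (exp_mul_exp_mul_sq_lt hpq).not_ge ?_
  rw [← hdiff, ← dslope_mul_sub f p q, mul_pow]
  exact mul_le_mul_of_nonneg_right hle (sq_nonneg _)

end ExponentialPrimitive

lemma isOpen_openInterval (a b : EReal) : IsOpen (openInterval a b) :=
  isOpen_Ioo.preimage continuous_coe_real_ereal

lemma convex_openInterval (a b : EReal) : Convex ℝ (openInterval a b) :=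
  convex_iff_ordConnected.mpr ⟨fun _ hx _ hy _ hz =>
    ⟨hx.1.trans_le (EReal.coe_le_coe_iff.mpr hz.1), (EReal.coe_le_coe_iff.mpr hz.2).trans_lt hy.2⟩⟩

theorem mainTheorem8_general (a b : EReal) (hab : a < b) :
    (∀ f : ℝ → ℝ, MatrixConvexOn 2 (openInterval a b) f →
      DifferentiableOn ℝ f (openInterval a b) ∧ deriv f ∈ ClassQ 2 (openInterval a b)) ∧
    (∀ n : ℕ, ∀ f : ℝ → ℝ, DifferentiableOn ℝ f (openInterval a b) →
      MatrixMonotoneOn n (openInterval a b) (deriv f) →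
      MatrixConvexOn n (openInterval a b) f) ∧
    (Real.exp ∈ ClassQ 2 (openInterval a b) ∧
      ¬ ∃ f : ℝ → ℝ, MatrixMonotoneOn 2 (openInterval a b) f ∧
        ∀ t ∈ openInterval a b, HasDerivAt f (Real.exp t) t) := by
  have hI := isOpen_openInterval a b
  have hc := convex_openInterval a b
  refine ⟨fun f hf => hf.deriv_mem_classQ hI hc, fun n f hf hm => ?_, ?_, ?_⟩
  · exact hm.matrixConvexOn hI hc fun x hx => (hf.differentiableAt (hI.mem_nhds hx)).hasDerivAt
  · exact mem_classQ_two_of_convexOn hI (fun x _ => Real.hasDerivAt_exp x)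
      (convexOn_exp.subset (subset_univ _) hc)
  · rintro ⟨f, hm, hf⟩
    exact not_matrixMonotoneOn_of_hasDerivAt_exp hI hc (EReal.lt_iff_exists_real_btwn.mp hab) hf hm

theorem mainTheorem8 (a b : EReal) (hab : a < b) :
    (∀ f : ℝ → ℝ, MatrixConvexOn 2 (openInterval a b) f →
      DifferentiableOn ℝ f (openInterval a b) ∧ deriv f ∈ ClassQ 2 (openInterval a b)) ∧
    (∀ f : ℝ → ℝ, DifferentiableOn ℝ f (openInterval a b) →
      MatrixMonotoneOn 2 (openInterval a b) (deriv f) →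
      MatrixConvexOn 2 (openInterval a b) f) ∧
    (Real.exp ∈ ClassQ 2 (openInterval a b) ∧
      ¬ ∃ f : ℝ → ℝ, MatrixConvexOn 2 (openInterval a b) f ∧
        MatrixMonotoneOn 2 (openInterval a b) f ∧
        ∀ t ∈ openInterval a b, HasDerivAt f (Real.exp t) t) :=
  have ⟨hconv, hmono, hexp, hnot⟩ := mainTheorem8_general a b hab
  ⟨hconv, hmono 2, hexp, fun ⟨f, _, hf⟩ => hnot ⟨f, hf⟩⟩
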